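/- Let $q\ge 2$ be an integer, $\beta>0$, $p=1-e^{-\beta}$ and $n\ge 1$. Let $\Lambda_n=[0,n]^3\cap(\mathbb Z+\frac12)^3$, an $n\times n\times n$ box of sites with nearest-neighbour adjacency. Let $\partial\Lambda_n$ be its outer vertex boundary in $(\mathbb Z+\frac12)^3$, and let $\partial_{\mathsf{blue}}$ and $\partial_{\mathsf{red}}$ be the parts of $\partial\Lambda_n$ in the lower half-space (the floor) and in the upper half-space (the other five faces). Let $E_n$ be the set of lattice edges with at least one endpoint in $\Lambda_n$; each edge is dual to the unit-square plaquette that it crosses at its midpoint. Let $\bar\pi_n^{\mathsf{fl}}$ be the law on $\omega\subset E_n$ (the open edges) proportional to $(p/(1-p))^{|\omega|}q^{\kappa(\omega)}$, where $\kappa(\omega)$ counts the open clusters in $\Lambda_n\cup\partial\Lambda_n$ when $\partial_{\mathsf{red}}$ is wired together and $\partial_{\mathsf{blue}}$ is wired together, conditioned on there being no open path from $\partial_{\mathsf{red}}$ to $\partial_{\mathsf{blue}}$. Let $\mathbf P_n^{\mathsf{fl}}$ be the FK–Potts law on pairs $(\omega,\sigma)$, with $\sigma$ a colouring by $\{1,\dots,q\}$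 equal to $1$ (blue) on $\partial_{\mathsf{blue}}$ and $2$ (red) on $\partial_{\mathsf{red}}$, proportional to $(p/(1-p))^{|\omega|}\prod_{uv\in\omega}\mathbf 1_{\{\sigma_u=\sigma_v\}}$; its marginal on $\omega$ is $\bar\pi_n^{\mathsf{fl}}$. Two plaquettes are 1-adjacent if they share an edge. The full interface $\mathcal I_{\mathsf{Full}}$ is the 1-connected component, in the set of plaquettes dual to the closed edges of $E_n$, that is incident to (shares an edge with) the boundary plaquettes, i.e. the height-$0$ horizontal plaquettes outside $[0,n]^2$, which separate the red upper half-space from the blue lower half-space outside the box. Let $\mathcal V_{\mathsf{blue}}$ (resp. $\mathcal V_{\mathsf{red}}$) be the set of sites of $\Lambda_n\cup\partial\Lambda_n$ joined to $\partial_{\mathsf{blue}}$ (resp. $\partial_{\mathsf{red}}$) by a nearest-neighbour path of blue (resp. red) sites, and let $\mathcal V_{\mathsf{bot}}$ (resp. $\mathcal V_{\mathsf{top}}$) be the set of sites joined to $\partial_{\mathsf{blue}}$ (resp. $\partial_{\mathsf{red}}$) by a path of open edges. For each of these four sets $\mathcal V$, let $\widehat{\mathcal V}$ be the union of $\mathcal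 V$ and all finite connected components of $(\mathbb Z+\frac12)^3\setminus\mathcal V$; the interfaces $\mathcal I_{\mathsf{blue}},\mathcal I_{\mathsf{red}},\mathcal I_{\mathsf{bot}},\mathcal I_{\mathsf{top}}$ are the sets of plaquettes dual to the edges of $E_n$ with exactly one endpoint in the corresponding $\widehat{\mathcal V}$. For $x\in[0,n]^2\cap(\mathbb Z+\frac12)^2$ (a column), $\overline{\mathrm{ht}}_x(I)$ and $\underline{\mathrm{ht}}_x(I)$ denote the largest and the smallest height at which the vertical line through $x$ meets the union of the plaquettes of $I$. **Lemma.** There is an absolute constant $C>0$ such that for every integer $q\ge 2$ there is $\beta_0>0$ such that for all $\beta\ge\beta_0$ and all $n\ge 1$, with $\delta=C/\beta$, $$\bar\pi_n^{\mathsf{fl}}\big(|\mathcal I_{\mathsf{Full}}|\ge(1+\delta)n^2\big)\le e^{-n^2}.$$ Moreover, for every $(\omega,\sigma)$ of positive probability under $\mathbf P_n^{\mathsf{fl}}$ with $|\mathcal I_{\mathsf{Full}}|<(1+\delta)n^2$: one has $\underline{\mathrm{ht}}_x(\mathcal I_{\mathsf{Full}})=\overline{\mathrm{ht}}_x(\mathcal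 I_{\mathsf{Full}})$ for all but at most $\delta n^2$ columns $x$; and for every column $x$ with this equality, $\mathcal I_{\mathsf{Full}}$ has exactly one plaquette meeting the vertical line through $x$, and this plaquette is also the only plaquette meeting that line in each of $\mathcal I_{\mathsf{bot}},\mathcal I_{\mathsf{blue}},\mathcal I_{\mathsf{red}},\mathcal I_{\mathsf{top}}$. -/

import Mathlib

namespace HardFloor

/-- Sites of the lattice `(ℤ + 1/2)³`: `x` stands for the point `x + (1/2, 1/2, 1/2)`. -/
abbrev Site := Fin 3 → ℤ

/-- Nearest-neighbour edges of `(ℤ + 1/2)³`: `(x, i)` is the edge joining `x` to `x + eᵢ`.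
The same pair also denotes the plaquette dual to this edge. -/
abbrev Edge := Site × Fin 3

/-- The first endpoint of an edge. -/
def tail (e : Edge) : Site := e.1

/-- The second endpoint of an edge. -/
def head (e : Edge) : Site := e.1 + Pi.single e.2 1

/-- The lattice `(ℤ + 1/2)³` with nearest-neighbour adjacency. -/
def lattice : SimpleGraph Site :=
  SimpleGraph.fromRel fun x y => ∃ e : Edge, x = tail e ∧ y = head e

/-- The subgraph of open edges (on all lattice sites). -/
def openGraph (ω : Finset Edge) : SimpleGraph Site :=
  SimpleGraph.fromRel fun x y => ∃ e ∈ ω, x = tail e ∧ y = head e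

/-- The lattice restricted to the sites of `S` (sites outside `S` are isolated). -/
def within (S : Set Site) : SimpleGraph Site :=
  SimpleGraph.fromRel fun x y => lattice.Adj x y ∧ x ∈ S ∧ y ∈ S

/-! ### The box and its boundary -/

/-- The `n × n × n` box: the sites of `(ℤ + 1/2)³` in `[0, n]² × [0, n]`. -/
noncomputable def box (n : ℕ) : Finset Site := Fintype.piFinset fun _ => Finset.Ico (0 : ℤ) n

/-- The outer vertex boundary of the box. -/
def bdry (n : ℕ) : Set Site := {x | x ∉ box n ∧ ∃ y ∈ box n, lattice.Adj x y}

/-- Boundary sites in the upper half-space (five faces): they are red. -/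
def redBdry (n : ℕ) : Set Site := {x ∈ bdry n | 0 ≤ x 2}

/-- Boundary sites in the lower half-space (the floor): they are blue. -/
def blueBdry (n : ℕ) : Set Site := {x ∈ bdry n | x 2 < 0}

/-- All sites of the graph: the box and its outer vertex boundary. -/
def verts (n : ℕ) : Set Site := (box n : Set Site) ∪ bdry n

/-- The edges of the model: all lattice edges with at least one endpoint in the box. -/
noncomputable def edges (n : ℕ) : Finset Edge :=
  (box n ×ˢ Finset.univ) ∪
    (box n ×ˢ Finset.univ).image fun e => (e.1 - Pi.single e.2 1, e.2)

/-! ### The random-cluster measure with a hard floor -/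

/-- The open edges, with the red boundary sites wired together and the blue boundary sites
wired together. -/
def wiredGraph (n : ℕ) (ω : Finset Edge) : SimpleGraph Site :=
  openGraph ω ⊔ SimpleGraph.fromRel fun x y =>
    (x ∈ redBdry n ∧ y ∈ redBdry n) ∨ (x ∈ blueBdry n ∧ y ∈ blueBdry n)

/-- The number of open clusters, with the two wired boundary classes. -/
noncomputable def clusterCount (n : ℕ) (ω : Finset Edge) : ℕ :=
  ((wiredGraph n ω).connectedComponentMk '' verts n).ncard

/-- The event that no open path joins the red boundary to the blue boundary. -/
def Disconnected (n : ℕ) (ω : Finset Edge) : Prop :=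
  ∀ x ∈ redBdry n, ∀ y ∈ blueBdry n, ¬ (openGraph ω).Reachable x y

/-- The random-cluster weight. -/
noncomputable def fkWeight (n : ℕ) (p : ℝ) (q : ℕ) (ω : Finset Edge) : ℝ :=
  (p / (1 - p)) ^ ω.card * (q : ℝ) ^ clusterCount n ω

open Classical in
/-- The probability of `A` under the wired-wired random-cluster measure on the box,
conditioned on the disconnection of the two boundary classes. -/
noncomputable def fkProb (n : ℕ) (p : ℝ) (q : ℕ) (A : Set (Finset Edge)) : ℝ :=
  (∑ ω ∈ (edges n).powerset with Disconnected n ω ∧ ω ∈ A, fkWeight n p q ω) /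
    ∑ ω ∈ (edges n).powerset with Disconnected n ω, fkWeight n p q ω

/-! ### The FK-Potts coupling with a hard floor

Colours are `1, …, q`, with `1` for blue and `2` for red. -/

/-- A colouring of the box, extended by the boundary condition: red in the upper half-space
and blue in the lower one (only the values on `verts n` are ever used). -/
noncomputable def extend (n : ℕ) (σ : box n → ℕ) (x : Site) : ℕ :=
  if h : x ∈ box n then σ ⟨x, h⟩ else if 0 ≤ x 2 then 2 else 1

/-- The FK-Potts weight of a pair, under the boundary condition. -/
noncomputable def jointWeight (n : ℕ) (p : ℝ) (z : Finset Edge × (box n → ℕ)) : ℝ :=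
  (p / (1 - p)) ^ z.1.card *
    ∏ e ∈ z.1, if extend n z.2 (tail e) = extend n z.2 (head e) then 1 else 0

/-- All pairs of an edge configuration and a colouring of the box by `1, …, q`. -/
noncomputable def pairs (n q : ℕ) : Finset (Finset Edge × (box n → ℕ)) :=
  (edges n).powerset ×ˢ Fintype.piFinset fun _ => Finset.Icc 1 q

open Classical in
/-- The probability of `A` under the FK-Potts law with a hard floor. -/
noncomputable def jointProb (n : ℕ) (p : ℝ) (q : ℕ)
    (A : Set (Finset Edge × (box n → ℕ))) : ℝ :=
  (∑ z ∈ pairs n q with z ∈ A, jointWeight n p z) / ∑ z ∈ pairs n q, jointWeight n p z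

/-! ### Plaquettes and the full interface -/

/-- The plaquette dual to an edge, as a closed unit square in `ℝ³`. -/
def plaquette (f : Edge) : Set (Fin 3 → ℝ) :=
  {y | y f.2 = f.1 f.2 + 1 ∧ ∀ j, j ≠ f.2 → (f.1 j : ℝ) ≤ y j ∧ y j ≤ f.1 j + 1}

/-- Two plaquettes share an edge: both contain the two endpoints `c`, `c + eᵢ` of a unit
segment with integer endpoints. -/
def ShareEdge (f g : Edge) : Prop :=
  ∃ (c : Fin 3 → ℤ) (i : Fin 3),
    (fun j => (c j : ℝ)) ∈ plaquette f ∩ plaquette g ∧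
    (fun j => ((c + Pi.single i 1 : Fin 3 → ℤ) j : ℝ)) ∈ plaquette f ∩ plaquette g

/-- The boundary plaquettes: those separating the red upper half-space from the blue lower
half-space outside the box, i.e. the height-zero horizontal plaquettes outside `[0, n]²`. -/
def bdryPlaquettes (n : ℕ) : Set Edge :=
  {f | f.2 = 2 ∧ tail f 2 = -1 ∧ head f ∉ box n}

open Classical in
/-- The full interface: the 1-connected component, in the set of plaquettes dual to closed
edges, that is incident to the boundary plaquettes. -/
noncomputable def fullInterface (n : ℕ) (ω : Finset Edge) : Finset Edge :=
  (edges n \ ω).filter fun f =>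
    ∃ b ∈ bdryPlaquettes n, ∃ g ∈ edges n \ ω, ShareEdge b g ∧
      Relation.ReflTransGen
        (fun a c => a ∈ edges n \ ω ∧ c ∈ edges n \ ω ∧ ShareEdge a c) g f

/-! ### The four interfaces -/

/-- The sites joined to the boundary class `B` by a path of sites of colour `c`. -/
def colourPhase (n : ℕ) (σ : box n → ℕ) (c : ℕ) (B : Set Site) : Set Site :=
  {v | ∃ u ∈ B, (within {x ∈ verts n | extend n σ x = c}).Reachable u v}

/-- The sites joined to the boundary class `B` by open paths. -/
def openPhase (ω : Finset Edge) (B : Set Site) : Set Site :=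
  {v | ∃ u ∈ B, (openGraph ω).Reachable u v}

/-- `S` together with its bubbles, the finite connected components of its complement. -/
def fill (S : Set Site) : Set Site :=
  S ∪ {x | x ∉ S ∧ {y | (within Sᶜ).Reachable x y}.Finite}

open Classical in
/-- The plaquettes dual to the edges of the model with exactly one endpoint in `S`. For the
four phases below and a pair of positive probability, these edges are all closed. -/
noncomputable def edgeBdry (n : ℕ) (S : Set Site) : Finset Edge :=
  (edges n).filter fun e => ¬ (tail e ∈ S ↔ head e ∈ S)

/-- The interface of the blue phase. -/
noncomputable def blueInterface (n : ℕ) (σ : box n → ℕ) : Finset Edge :=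
  edgeBdry n (fill (colourPhase n σ 1 (blueBdry n)))

/-- The interface of the red phase. -/
noncomputable def redInterface (n : ℕ) (σ : box n → ℕ) : Finset Edge :=
  edgeBdry n (fill (colourPhase n σ 2 (redBdry n)))

/-- The interface of the open cluster of the blue boundary. -/
noncomputable def botInterface (n : ℕ) (ω : Finset Edge) : Finset Edge :=
  edgeBdry n (fill (openPhase ω (blueBdry n)))

/-- The interface of the open cluster of the red boundary. -/
noncomputable def topInterface (n : ℕ) (ω : Finset Edge) : Finset Edge :=
  edgeBdry n (fill (openPhase ω (redBdry n)))

/-! ### Columns and heights -/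

/-- The columns of the box: `(a, b)` stands for `(a + 1/2, b + 1/2)`. -/
noncomputable def columns (n : ℕ) : Finset (ℤ × ℤ) := Finset.Ico (0 : ℤ) n ×ˢ Finset.Ico (0 : ℤ) n

/-- The point at height `t` on the vertical line through the centre of a column. -/
noncomputable def columnPoint (x : ℤ × ℤ) (t : ℝ) : Fin 3 → ℝ :=
  ![(x.1 : ℝ) + 1 / 2, (x.2 : ℝ) + 1 / 2, t]

/-- The heights at which a set of plaquettes meets the line of a column. -/
def heights (I : Finset Edge) (x : ℤ × ℤ) : Set ℝ :=
  {t | ∃ f ∈ I, columnPoint x t ∈ plaquette f}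

/-- The maximal height of `I` above a column. -/
noncomputable def maxHeight (I : Finset Edge) (x : ℤ × ℤ) : ℝ := sSup (heights I x)

/-- The minimal height of `I` above a column. -/
noncomputable def minHeight (I : Finset Edge) (x : ℤ × ℤ) : ℝ := sInf (heights I x)

/-- The plaquettes of `I` that meet the line of a column. -/
def above (I : Finset Edge) (x : ℤ × ℤ) : Set Edge :=
  {f | f ∈ I ∧ ∃ t : ℝ, columnPoint x t ∈ plaquette f}

end HardFloor

namespace HardFloor

/-! ### Closed cochains of the lattice are exact -/

section Cochain

variable {A : Type*} [AddCommGroup A]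

/-! The estimate is a Peierls comparison with a flat interface. Let I be the full interface, with n²
+ M plaquettes and M ≥ 1. Opening I and closing the floor edges (`flatten`) keeps the two boundary
classes disconnected and gains at least M open edges, hence a factor (e^β - 1)^M. Given I, only the
states of the floor edges are forgotten, which costs 2^(n²). It remains to bound the clusters lost
and the number of possible I.

Both the cluster bound and the deterministic claims rest on `exists_subset_box_separates`. The
plaquettes dual to the sides of a unit square pairwise share an edge, and I is a 1-connected
component, so removing I and the boundary plaquettes from a closed edge boundary leaves a set
meeting every square evenly. Exactness of cochains mod 2 makes this set an edge boundary again.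
Hence each phase interface lies in I (`IsPhase.edgeBdry_subset`), and a cluster inside the box that
is touched by I is touched along at least two plaquettes (`exists_ne_separates`).

Each phase interface crosses every column. So each of the two wired clusters owns n² of the 2|I|
endpoints of edges dual to I, and every other touched cluster owns at least two: at most M + 2 ≤ 3M
clusters are lost (`ncard_touched_add_le`), a factor at most q^(3M). For the entropy, prescribing
the edges in a neighbourhood of I and of the rim forces I to be the full interface. The resulting
disjoint families of configurations give a summable weight (`sum_half_pow_le_one`), so no
enumeration of connected sets is needed. For large β, half of the exponent βM pays for all this and
the other half beats the terms of order n².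

Deterministically, I has a plaquette in every column and a second one wherever the extreme heights
differ, so its excess area bounds the number of such columns. Where the heights agree, each phase
interface is a nonempty part of a single plaquette. -/

/-- The discrete primitive of `h` vanishing at `0`. -/
noncomputable def primitive (h : ℤ → A) (t : ℤ) : A :=
  ∑ s ∈ Finset.Ico 0 t, h s - ∑ s ∈ Finset.Ico t 0, h s

theorem primitive_zero (h : ℤ → A) : primitive h 0 = 0 := by
  simp [primitive]

theorem primitive_succ (h : ℤ → A) (t : ℤ) : primitive h (t + 1) = primitive h t + h t := by
  unfold primitive
  rcases le_or_gt 0 t with ht | ht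
  · have h1 : Finset.Ico 0 (t + 1) = insert t (Finset.Ico 0 t) := by ext; simp; omega
    have h2 : Finset.Ico (t + 1) 0 = ∅ := by ext; simp; omega
    have h3 : Finset.Ico t 0 = ∅ := by ext; simp; omega
    rw [h1, h2, h3, Finset.sum_insert (by simp)]
    simp [add_comm]
  · have h1 : Finset.Ico t 0 = insert t (Finset.Ico (t + 1) 0) := by ext; simp; omega
    have h2 : Finset.Ico 0 (t + 1) = ∅ := by ext; simp; omega
    have h3 : Finset.Ico 0 t = ∅ := by ext; simp; omega
    rw [h1, h2, h3, Finset.sum_insert (by simp)]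
    simp

theorem primitive_sub (h k : ℤ → A) (t : ℤ) :
    primitive (fun s => h s - k s) t = primitive h t - primitive k t := by
  simp only [primitive, Finset.sum_sub_distrib]
  abel

theorem primitive_diff (f : ℤ → A) (t : ℤ) :
    primitive (fun s => f (s + 1) - f s) t = f t - f 0 := by
  induction t using Int.induction_on with
  | zero => simp [primitive_zero]
  | succ i ih => rw [primitive_succ, ih]; abel
  | pred i ih =>
    have := primitive_succ (fun s => f (s + 1) - f s) (-(i : ℤ) - 1)
    simp only [sub_add_cancel] at this
    rw [ih] at this
    rw [← sub_eq_iff_eq_add.2 this]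
    abel

theorem vec_add_single_zero (a b c : ℤ) :
    (![a, b, c] : Site) + Pi.single 0 1 = ![a + 1, b, c] := by
  ext i; fin_cases i <;> simp

theorem vec_add_single_one (a b c : ℤ) :
    (![a, b, c] : Site) + Pi.single 1 1 = ![a, b + 1, c] := by
  ext i; fin_cases i <;> simp

theorem vec_add_single_two (a b c : ℤ) :
    (![a, b, c] : Site) + Pi.single 2 1 = ![a, b, c + 1] := by
  ext i; fin_cases i <;> simp

theorem site_eq_vec (x : Site) : x = ![x 0, x 1, x 2] := by
  ext i; fin_cases i <;> simp

/-- A closed cochain on the edges of the lattice has a potential. -/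
theorem exists_potential (c : Edge → A)
    (h : ∀ x i j, c (x, i) + c (x + Pi.single i 1, j) = c (x, j) + c (x + Pi.single j 1, i)) :
    ∃ g : Site → A, ∀ x i, g (x + Pi.single i 1) = g x + c (x, i) := by
  have h01 : ∀ a b t, c (![a + 1, b, t], 1) - c (![a, b, t], 1) =
      c (![a, b + 1, t], 0) - c (![a, b, t], 0) := by
    intro a b t
    have := h ![a, b, t] 0 1
    rw [vec_add_single_zero, vec_add_single_one] at this
    rw [sub_eq_sub_iff_add_eq_add, add_comm, this, add_comm]
  have h02 : ∀ a b t, c (![a + 1, b, t], 2) - c (![a, b, t], 2) =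
      c (![a, b, t + 1], 0) - c (![a, b, t], 0) := by
    intro a b t
    have := h ![a, b, t] 0 2
    rw [vec_add_single_zero, vec_add_single_two] at this
    rw [sub_eq_sub_iff_add_eq_add, add_comm, this, add_comm]
  have h12 : ∀ a b t, c (![a, b + 1, t], 2) - c (![a, b, t], 2) =
      c (![a, b, t + 1], 1) - c (![a, b, t], 1) := by
    intro a b t
    have := h ![a, b, t] 1 2
    rw [vec_add_single_one, vec_add_single_two] at this
    rw [sub_eq_sub_iff_add_eq_add, add_comm, this, add_comm]
  have e01 : ∀ a b, primitive (fun s => c (![a + 1, s, 0], 1)) b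
      - primitive (fun s => c (![a, s, 0], 1)) b = c (![a, b, 0], 0) - c (![a, 0, 0], 0) := by
    intro a b
    rw [← primitive_sub]
    simp only [h01]
    exact primitive_diff (fun s => c (![a, s, 0], 0)) b
  have e02 : ∀ a b t, primitive (fun s => c (![a + 1, b, s], 2)) t
      - primitive (fun s => c (![a, b, s], 2)) t = c (![a, b, t], 0) - c (![a, b, 0], 0) := by
    intro a b t
    rw [← primitive_sub]
    simp only [h02]
    exact primitive_diff (fun s => c (![a, b, s], 0)) t
  have e12 : ∀ a b t, primitive (fun s => c (![a, b + 1, s], 2)) t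
      - primitive (fun s => c (![a, b, s], 2)) t = c (![a, b, t], 1) - c (![a, b, 0], 1) := by
    intro a b t
    rw [← primitive_sub]
    simp only [h12]
    exact primitive_diff (fun s => c (![a, b, s], 1)) t
  -- Integrate along the staircase path from the origin: first coordinate, then second, then third.
  -- The identities `e01`, `e02`, `e12` say how a later leg changes when an earlier coordinate moves
  -- by one.
  refine ⟨fun x => primitive (fun s => c (![s, 0, 0], 0)) (x 0)
    + primitive (fun s => c (![x 0, s, 0], 1)) (x 1)
    + primitive (fun s => c (![x 0, x 1, s], 2)) (x 2), fun x i => ?_⟩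
  rw [site_eq_vec x]
  generalize x 0 = a
  generalize x 1 = b
  generalize x 2 = t
  fin_cases i
  · change _ = _ + c (![a, b, t], 0)
    simp only [Fin.zero_eta, vec_add_single_zero]
    simp only [Matrix.cons_val_zero, Matrix.cons_val_one, Matrix.cons_val]
    rw [primitive_succ, sub_eq_iff_eq_add.1 (e01 a b), sub_eq_iff_eq_add.1 (e02 a b t)]
    abel
  · change _ = _ + c (![a, b, t], 1)
    simp only [Fin.mk_one, vec_add_single_one]
    simp only [Matrix.cons_val_zero, Matrix.cons_val_one, Matrix.cons_val]
    rw [primitive_succ, sub_eq_iff_eq_add.1 (e12 a b t)]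
    abel
  · change _ = _ + c (![a, b, t], 2)
    simp only [Fin.reduceFinMk, vec_add_single_two]
    simp only [Matrix.cons_val_zero, Matrix.cons_val_one, Matrix.cons_val]
    rw [primitive_succ]
    abel

end Cochain

/-! ### Edge boundaries -/

/-- The edge `e` has exactly one endpoint in `S`. -/
def Separates (S : Set Site) (e : Edge) : Prop := ¬ (tail e ∈ S ↔ head e ∈ S)

theorem separates_compl (S : Set Site) (e : Edge) : Separates Sᶜ e ↔ Separates S e := by
  simp only [Separates, Set.mem_compl_iff]
  tauto

open Classical in
/-- The indicator of `P` in `ZMod 2`. -/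
noncomputable def bit (P : Prop) : ZMod 2 := if P then 1 else 0

theorem bit_true {P : Prop} (h : P) : bit P = 1 := by simp [bit, h]

theorem bit_false {P : Prop} (h : ¬ P) : bit P = 0 := by simp [bit, h]

theorem bit_separates (S : Set Site) (x : Site) (i : Fin 3) :
    bit (Separates S (x, i)) = bit (x ∈ S) + bit (x + Pi.single i 1 ∈ S) := by
  have h11 : (1 : ZMod 2) + 1 = 0 := rfl
  by_cases h1 : x ∈ S <;> by_cases h2 : x + Pi.single i 1 ∈ S <;>
    simp [bit, Separates, tail, head, h1, h2, h11]

/-- A set of edges meeting every unit square in an even number of edges is an edge boundary. -/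
theorem exists_separates_iff (X : Set Edge)
    (h : ∀ x i j, bit ((x, i) ∈ X) + bit ((x + Pi.single i 1, j) ∈ X) =
      bit ((x, j) ∈ X) + bit ((x + Pi.single j 1, i) ∈ X)) :
    ∃ G : Set Site, ∀ e, Separates G e ↔ e ∈ X := by
  obtain ⟨g, hg⟩ := exists_potential (fun e => bit (e ∈ X)) h
  refine ⟨{x | g x = 1}, fun ⟨x, i⟩ => ?_⟩
  have key : ∀ a b : ZMod 2, (¬ (a = 1 ↔ b = 1)) ↔ b = a + 1 := by decide
  have key0 : ∀ a b : ZMod 2, b = a + 0 → (a = 1 ↔ b = 1) := by decide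
  have := hg x i
  simp only [Separates, tail, head, Set.mem_ofPred_eq]
  by_cases hX : (x, i) ∈ X
  · rw [bit_true hX] at this
    simp only [hX, iff_true]
    exact (key _ _).2 this
  · rw [bit_false hX] at this
    simp only [hX, iff_false, not_not]
    exact key0 _ _ this

/-! ### The box and its complement -/

theorem mem_box {n : ℕ} {x : Site} : x ∈ box n ↔ ∀ i, 0 ≤ x i ∧ x i < n := by
  simp [box, Fintype.mem_piFinset]

theorem mem_edges {n : ℕ} {e : Edge} : e ∈ edges n ↔ tail e ∈ box n ∨ head e ∈ box n := by
  obtain ⟨x, i⟩ := e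
  simp only [edges, Finset.mem_union, Finset.mem_product, Finset.mem_univ, and_true,
    Finset.mem_image, tail, head]
  refine or_congr Iff.rfl ⟨?_, fun h => ⟨(x + Pi.single i 1, i), h, by simp⟩⟩
  rintro ⟨⟨y, j⟩, hy, he⟩
  simp only [Prod.mk.injEq] at he
  obtain ⟨rfl, rfl⟩ := he
  simpa using hy

theorem lattice_adj {x y : Site} :
    lattice.Adj x y ↔ ∃ i, y = x + Pi.single i 1 ∨ x = y + Pi.single i 1 := by
  simp only [lattice, SimpleGraph.fromRel_adj, tail, head]
  constructor
  · rintro ⟨-, ⟨⟨z, i⟩, rfl, rfl⟩ | ⟨⟨z, i⟩, rfl, rfl⟩⟩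
    exacts [⟨i, Or.inl rfl⟩, ⟨i, Or.inr rfl⟩]
  · rintro ⟨i, rfl | rfl⟩
    · exact ⟨by simp, Or.inl ⟨(x, i), rfl, rfl⟩⟩
    · exact ⟨by simp, Or.inr ⟨(y, i), rfl, rfl⟩⟩

theorem lattice_adj_edge (e : Edge) : lattice.Adj (tail e) (head e) :=
  lattice_adj.2 ⟨e.2, Or.inl rfl⟩

/-- A property invariant along all edges of a line is invariant along the line. -/
theorem iff_update_of_line {P : Site → Prop} (x : Site) (i : Fin 3)
    (h : ∀ t, P (Function.update x i t) ↔ P (Function.update x i (t + 1))) (t : ℤ) :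
    P x ↔ P (Function.update x i t) := by
  have key : ∀ t, P (Function.update x i 0) ↔ P (Function.update x i t) := by
    intro t
    induction t using Int.induction_on with
    | zero => rfl
    | succ k ih => exact ih.trans (h _)
    | pred k ih =>
      have := h (-(k : ℤ) - 1)
      rw [sub_add_cancel] at this
      exact ih.trans this.symm
  have := key (x i)
  rw [Function.update_eq_self] at this
  exact this.symm.trans (key t)

theorem update_add_single (x : Site) (i : Fin 3) (t : ℤ) :
    Function.update x i t + Pi.single i 1 = Function.update x i (t + 1) := by
  ext j
  by_cases hj : j = i
  · subst hj; simp
  · simp [hj]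

/-- The complement of the box is connected. -/
theorem iff_of_notMem_box {n : ℕ} {P : Site → Prop}
    (h : ∀ x i, x ∉ box n → x + Pi.single i 1 ∉ box n → (P x ↔ P (x + Pi.single i 1)))
    {x y : Site} (hx : x ∉ box n) (hy : y ∉ box n) : P x ↔ P y := by
  -- A line along which some fixed coordinate is out of range never enters the box.
  have move : ∀ (x : Site) (i j : Fin 3), j ≠ i → ¬ (0 ≤ x j ∧ x j < n) → ∀ t,
      P x ↔ P (Function.update x i t) := by
    intro x i j hij hj t
    refine iff_update_of_line x i (fun t => ?_) t
    rw [← update_add_single]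
    refine h _ _ (fun hb => hj ?_) (fun hb => hj ?_)
    · simpa [hij] using mem_box.1 hb j
    · simpa [hij] using mem_box.1 hb j
  have main : ∀ x, x ∉ box n → (P x ↔ P (fun _ => -1)) := by
    intro x hx
    obtain ⟨j, hj⟩ : ∃ j, ¬ (0 ≤ x j ∧ x j < n) := by
      by_contra! hc
      exact hx (mem_box.2 hc)
    obtain ⟨i, k, hji, hki, hjk, hall⟩ :
        ∃ i k : Fin 3, j ≠ i ∧ k ≠ i ∧ j ≠ k ∧ ∀ l, l = i ∨ l = j ∨ l = k :=
      (by decide : ∀ j : Fin 3, ∃ i k : Fin 3, j ≠ i ∧ k ≠ i ∧ j ≠ k ∧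
        ∀ l, l = i ∨ l = j ∨ l = k) j
    -- The bad coordinate `j` protects the move of `i` to -1; then `i` is itself out of range and
    -- protects the moves of `j` and `k`.
    rw [move x i j hji hj (-1), move _ j i hji.symm (by simp) (-1),
      move _ k i hki.symm (by simp [hji.symm]) (-1)]
    apply iff_of_eq
    congr 1
    ext l
    rcases hall l with rfl | rfl | rfl <;> simp [Function.update_apply]
  exact (main x hx).trans (main y hy).symm

/-! ### Plaquettes sharing an edge -/

theorem mem_plaquette_intCast {f : Edge} {c : Fin 3 → ℤ} :
    (fun j => (c j : ℝ)) ∈ plaquette f ↔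
      c f.2 = f.1 f.2 + 1 ∧ ∀ j, j ≠ f.2 → f.1 j ≤ c j ∧ c j ≤ f.1 j + 1 := by
  simp only [plaquette, Set.mem_ofPred_eq]
  norm_cast

theorem ShareEdge.symm {f g : Edge} (h : ShareEdge f g) : ShareEdge g f := by
  obtain ⟨c, i, h1, h2⟩ := h
  exact ⟨c, i, h1.symm, h2.symm⟩

/-- The edges of the unit square at `x` in the directions `i`, `j`. -/
def square (x : Site) (i j : Fin 3) : Set Edge :=
  {(x, i), (x + Pi.single i 1, j), (x, j), (x + Pi.single j 1, i)}

/-- The four dual plaquettes all contain the unit segment through the centre of the square in the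
third direction `k`, which starts at the integer point x + eᵢ + eⱼ. -/
theorem shareEdge_of_mem_square {x : Site} {i j : Fin 3} (hij : i ≠ j) {e f : Edge}
    (he : e ∈ square x i j) (hf : f ∈ square x i j) : ShareEdge e f := by
  obtain ⟨k, hki, hkj⟩ : ∃ k : Fin 3, k ≠ i ∧ k ≠ j :=
    (by decide : ∀ i j : Fin 3, ∃ k : Fin 3, k ≠ i ∧ k ≠ j) i j
  have key : ∀ e ∈ square x i j,
      (fun l => (((x + Pi.single i 1 + Pi.single j 1 : Site) l : ℤ) : ℝ)) ∈ plaquette e ∧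
      (fun l => (((x + Pi.single i 1 + Pi.single j 1 : Site) + Pi.single k 1 : Fin 3 → ℤ) l : ℝ))
        ∈ plaquette e := by
    intro e he
    rw [mem_plaquette_intCast, mem_plaquette_intCast]
    have hs : ∀ a b : Fin 3, (Pi.single a 1 : Site) b = if b = a then 1 else 0 := fun a b => by
      simp [Pi.single_apply]
    rcases he with rfl | rfl | rfl | rfl <;> simp only [Pi.add_apply, hs] <;>
      refine ⟨⟨?_, fun l hl => ?_⟩, ?_, fun l hl => ?_⟩ <;> revert hki hkj hij <;>
      split_ifs <;> intros <;> omega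
  exact ⟨_, k, ⟨(key e he).1, (key f hf).1⟩, ⟨(key e he).2, (key f hf).2⟩⟩

/-! ### Splitting an edge boundary along the full interface -/

theorem mem_fullInterface {n : ℕ} {ω : Finset Edge} {f : Edge} :
    f ∈ fullInterface n ω ↔ f ∈ edges n \ ω ∧
      ∃ b ∈ bdryPlaquettes n, ∃ g ∈ edges n \ ω, ShareEdge b g ∧
      Relation.ReflTransGen
        (fun a c => a ∈ edges n \ ω ∧ c ∈ edges n \ ω ∧ ShareEdge a c) g f := by
  simp [fullInterface]

theorem fullInterface_subset (n : ℕ) (ω : Finset Edge) : fullInterface n ω ⊆ edges n \ ω :=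
  fun _ h => (mem_fullInterface.1 h).1

theorem mem_fullInterface_of_shareEdge {n : ℕ} {ω : Finset Edge} {e f : Edge}
    (he : e ∈ fullInterface n ω) (hf : f ∈ edges n \ ω) (h : ShareEdge e f) :
    f ∈ fullInterface n ω := by
  obtain ⟨he', b, hb, g, hg, hbg, hp⟩ := mem_fullInterface.1 he
  exact mem_fullInterface.2 ⟨hf, b, hb, g, hg, hbg, hp.tail ⟨he', hf, h⟩⟩

theorem mem_fullInterface_of_bdry {n : ℕ} {ω : Finset Edge} {b f : Edge}
    (hb : b ∈ bdryPlaquettes n) (hf : f ∈ edges n \ ω) (h : ShareEdge b f) :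
    f ∈ fullInterface n ω :=
  mem_fullInterface.2 ⟨hf, b, hb, f, hf, h, .refl⟩

/-- The part of an edge boundary off the full interface and the boundary plaquettes is the edge
boundary of a subset of the box. -/
theorem exists_subset_box_separates {n : ℕ} {ω : Finset Edge} {S : Set Site}
    (hS : ∀ e, Separates S e → e ∈ edges n \ ω ∨ e ∈ bdryPlaquettes n) :
    ∃ G : Set Site, G ⊆ box n ∧ ∀ e, Separates G e ↔
      Separates S e ∧ e ∉ fullInterface n ω ∧ e ∉ bdryPlaquettes n := by
  set X : Set Edge := {e | Separates S e ∧ e ∉ fullInterface n ω ∧ e ∉ bdryPlaquettes n} with hX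
  -- Maximality of the component: on each square, `X` contains either all the edges separating `S`
  -- or none, so it inherits the even parity of an edge boundary.
  have hlink : ∀ e f, ShareEdge e f → Separates S e → Separates S f → e ∉ X → f ∉ X := by
    rintro e f hef he hf heX ⟨-, hf1, hf2⟩
    have hfc := (hS f hf).resolve_right hf2
    simp only [hX, Set.mem_ofPred_eq, he, true_and, not_and_or, not_not] at heX
    rcases heX with heX | heX
    · exact hf1 (mem_fullInterface_of_shareEdge heX hfc hef)
    · exact hf1 (mem_fullInterface_of_bdry heX hfc hef)
  obtain ⟨G, hG⟩ := exists_separates_iff X (by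
    intro x i j
    rcases eq_or_ne i j with rfl | hij
    · rfl
    by_cases hex : ∃ e ∈ square x i j, Separates S e ∧ e ∉ X
    · obtain ⟨e, he, heS, heX⟩ := hex
      have hno : ∀ f ∈ square x i j, f ∉ X := fun f hf hfX =>
        hlink e f (shareEdge_of_mem_square hij he hf) heS hfX.1 heX hfX
      rw [bit_false (hno _ (by simp [square])), bit_false (hno _ (by simp [square])),
        bit_false (hno _ (by simp [square])), bit_false (hno _ (by simp [square]))]
    · push Not at hex
      have hiff : ∀ f ∈ square x i j, bit (f ∈ X) = bit (Separates S f) := fun f hf => by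
        congr 1
        exact propext ⟨fun h => h.1, hex f hf⟩
      rw [hiff _ (by simp [square]), hiff _ (by simp [square]), hiff _ (by simp [square]),
        hiff _ (by simp [square]), bit_separates, bit_separates, bit_separates, bit_separates,
        add_right_comm x]
      have h2 : ∀ a b c d : ZMod 2, a + b + (b + c) = a + d + (d + c) := by decide
      exact h2 _ _ _ _)
  have hGe : ∀ e, Separates G e → e ∈ edges n := fun e he => by
    obtain ⟨h1, -, h3⟩ := (hG e).1 he
    exact (Finset.mem_sdiff.1 ((hS e h1).resolve_right h3)).1
  have hout : ∀ {x y : Site}, x ∉ box n → y ∉ box n → (x ∈ G ↔ y ∈ G) := by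
    intro x y hx hy
    refine iff_of_notMem_box (P := fun x => x ∈ G) (fun x i h1 h2 => ?_) hx hy
    by_contra hc
    exact (mem_edges.1 (hGe (x, i) hc)).elim h1 h2
  -- The potential is determined up to a constant only. As `G` is constant off the box, either it or
  -- its complement lies in the box.
  by_cases h0 : ∃ x, x ∉ box n ∧ x ∈ G
  · obtain ⟨x, hx, hxG⟩ := h0
    refine ⟨Gᶜ, fun y hy => ?_, fun e => (separates_compl G e).trans (hG e)⟩
    by_contra hyb
    exact hy ((hout hx hyb).1 hxG)
  · push Not at h0
    refine ⟨G, fun y hy => ?_, hG⟩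
    by_contra hyb
    exact h0 y hyb hy


/-! ### Filled phases -/

theorem within_adj {S : Set Site} {x y : Site} :
    (within S).Adj x y ↔ lattice.Adj x y ∧ x ∈ S ∧ y ∈ S := by
  simp only [within, SimpleGraph.fromRel_adj]
  constructor
  · rintro ⟨-, h | h⟩
    exacts [h, ⟨h.1.symm, h.2.2, h.2.1⟩]
  · exact fun h => ⟨h.1.ne, Or.inl h⟩

theorem iff_of_reachable {G : SimpleGraph Site} {P : Site → Prop} {x y : Site}
    (h : G.Reachable x y) (hP : ∀ u v, G.Reachable x u → G.Adj u v → (P u ↔ P v)) :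
    P x ↔ P y := by
  rw [SimpleGraph.reachable_iff_reflTransGen] at h
  induction h with
  | refl => rfl
  | tail h1 h2 ih =>
    exact ih.trans (hP _ _ ((SimpleGraph.reachable_iff_reflTransGen _ _).2 h1) h2)

theorem notMem_of_reachable_within_compl {V : Set Site} {x y : Site} (hx : x ∉ V)
    (h : (within Vᶜ).Reachable x y) : y ∉ V := by
  rw [SimpleGraph.reachable_iff_reflTransGen] at h
  cases h with
  | refl => exact hx
  | tail _ h2 => exact (within_adj.1 h2).2.2

theorem subset_fill (V : Set Site) : V ⊆ fill V := Set.subset_union_left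

theorem mem_fill_iff_of_reachable {V : Set Site} {x y : Site} (hx : x ∉ V)
    (h : (within Vᶜ).Reachable x y) : x ∈ fill V ↔ y ∈ fill V := by
  have hy := notMem_of_reachable_within_compl hx h
  simp only [fill, Set.mem_union, hx, hy, Set.mem_ofPred_eq, false_or, not_false_eq_true, true_and]
  have : {z | (within Vᶜ).Reachable x z} = {z | (within Vᶜ).Reachable y z} := by
    ext z
    exact ⟨fun hz => h.symm.trans hz, fun hz => h.trans hz⟩
  rw [this]

theorem mem_of_mem_fill_of_adj {V : Set Site} {x y : Site} (hx : x ∈ fill V) (hy : y ∉ fill V)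
    (h : lattice.Adj x y) : x ∈ V := by
  by_contra hxV
  have hyV : y ∉ V := fun h => hy (subset_fill V h)
  exact hy ((mem_fill_iff_of_reachable hxV
    (within_adj.2 ⟨h, hxV, hyV⟩ : (within Vᶜ).Adj x y).reachable).1 hx)

/-- Bubbles are whole components of the complement, so filling removes boundary edges and creates
none. Interface edges thus inherit closedness from the phase. -/
theorem Separates.of_fill {V : Set Site} {e : Edge} (h : Separates (fill V) e) :
    Separates V e := by
  intro hV
  have ha := lattice_adj_edge e
  by_cases h1 : tail e ∈ fill V <;> by_cases h2 : head e ∈ fill V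
  · exact h ⟨fun _ => h2, fun _ => h1⟩
  · exact h2 (subset_fill V (hV.1 (mem_of_mem_fill_of_adj h1 h2 ha)))
  · exact h1 (subset_fill V (hV.2 (mem_of_mem_fill_of_adj h2 h1 ha.symm)))
  · exact h ⟨fun h => absurd h h1, fun h => absurd h h2⟩

theorem mem_edgeBdry {n : ℕ} {S : Set Site} {e : Edge} :
    e ∈ edgeBdry n S ↔ e ∈ edges n ∧ Separates S e := by
  simp [edgeBdry, Separates]

theorem apply_bounds_of_mem_bdry {n : ℕ} {x : Site} (h : x ∈ bdry n) (j : Fin 3) :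
    -1 ≤ x j ∧ x j ≤ n := by
  obtain ⟨-, y, hy, ha⟩ := h
  obtain ⟨i, rfl | rfl⟩ := lattice_adj.1 ha
  · have := mem_box.1 hy j
    simp only [Pi.add_apply, Pi.single_apply] at this
    split_ifs at this <;> omega
  · have := mem_box.1 hy j
    simp only [Pi.add_apply, Pi.single_apply]
    split_ifs <;> omega

theorem lattice_adj_update (x : Site) (i : Fin 3) (t : ℤ) :
    lattice.Adj (Function.update x i t) (Function.update x i (t + 1)) :=
  lattice_adj.2 ⟨i, Or.inl (update_add_single x i t).symm⟩

theorem infinite_of_update_mem {C : Set Site} (x : Site) (j : Fin 3) (t : ℕ → ℤ)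
    (ht : Function.Injective t) (h : ∀ k, Function.update x j (t k) ∈ C) : C.Infinite :=
  Set.infinite_of_injective_forall_mem
    (fun _ _ hkl => ht (Function.update_injective x j hkl)) h

/-- Filling the bubbles of a phase adds no site outside the box. -/
theorem mem_fill_of_notMem_box {n : ℕ} {V : Set Site} (hV : ∀ x, x ∉ box n → x ∈ V → x ∈ bdry n)
    {x : Site} (hx : x ∉ box n) : x ∈ fill V ↔ x ∈ V := by
  refine ⟨fun h => ?_, fun h => subset_fill V h⟩
  by_contra hxV
  have hfin := (h.resolve_left hxV).2
  obtain ⟨j, hj⟩ : ∃ j, ¬ (0 ≤ x j ∧ x j < n) := by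
    by_contra! hc
    exact hx (mem_box.2 hc)
  have hfar : ∀ t : ℤ, t < -1 ∨ (n : ℤ) < t → Function.update x j t ∉ V := by
    intro t ht htV
    have hb : Function.update x j t ∉ box n := fun hb => by
      have := mem_box.1 hb j
      simp only [Function.update_self] at this
      omega
    have := apply_bounds_of_mem_bdry (hV _ hb htV) j
    simp only [Function.update_self] at this
    omega
  -- The ray from `x` pointing away from the box in direction `j` avoids `V`: `x` itself, possibly
  -- in the boundary layer, does so by assumption, and later sites lie beyond that layer. The
  -- component of `x` is therefore infinite.
  rcases lt_or_ge (x j) 0 with h0 | h0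
  · have hnot : ∀ k : ℕ, Function.update x j (x j - k) ∉ V := by
      rintro (_ | k)
      · simpa using hxV
      · exact hfar _ (by push_cast; omega)
    refine infinite_of_update_mem x j (fun k => x j - k) (fun a b h => by simpa using h)
      (fun k => ?_) hfin
    change (within Vᶜ).Reachable _ _
    induction k with
    | zero => simp
    | succ k ih =>
      have ha := lattice_adj_update x j (x j - (k + 1 : ℕ))
      rw [show x j - ((k + 1 : ℕ) : ℤ) + 1 = x j - k by push_cast; ring] at ha
      exact ih.trans (within_adj.2 ⟨ha.symm, hnot k, hnot (k + 1)⟩ :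
        (within Vᶜ).Adj _ _).reachable
  · have hnot : ∀ k : ℕ, Function.update x j (x j + k) ∉ V := by
      rintro (_ | k)
      · simpa using hxV
      · exact hfar _ (by push_cast; omega)
    refine infinite_of_update_mem x j (fun k => x j + k) (fun a b h => by simpa using h)
      (fun k => ?_) hfin
    change (within Vᶜ).Reachable _ _
    induction k with
    | zero => simp
    | succ k ih =>
      have ha := lattice_adj_update x j (x j + k)
      rw [show x j + (k : ℤ) + 1 = x j + (k + 1 : ℕ) by push_cast; ring] at ha
      exact ih.trans (within_adj.2 ⟨ha, hnot k, hnot (k + 1)⟩ :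
        (within Vᶜ).Adj _ _).reachable

/-- A set of sites growing from the part of the boundary of the box in the upper or the lower
half-space `Q`, and separated from its complement by closed edges. -/
structure IsPhase (n : ℕ) (ω : Finset Edge) (Q : Site → Prop) (V : Set Site) : Prop where
  side : (∀ x, Q x ↔ 0 ≤ x 2) ∨ ∀ x, Q x ↔ x 2 < 0
  outside : ∀ x, x ∉ box n → (x ∈ V ↔ x ∈ bdry n ∧ Q x)
  closed : ∀ e ∈ edges n, Separates V e → e ∉ ω
  joined : ∀ v ∈ V, ∃ u, u ∉ box n ∧ (within V).Reachable v u

theorem notMem_edges_of_mem_bdryPlaquettes {n : ℕ} {e : Edge} (h : e ∈ bdryPlaquettes n) :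
    e ∉ edges n := by
  rw [mem_edges, not_or]
  refine ⟨fun hb => ?_, h.2.2⟩
  have := (mem_box.1 hb 2).1
  rw [h.2.1] at this
  omega

theorem mem_verts_of_mem_edges {n : ℕ} {e : Edge} (h : e ∈ edges n) :
    tail e ∈ verts n ∧ head e ∈ verts n := by
  have ha := lattice_adj_edge e
  simp only [verts, bdry, Set.mem_union, Finset.mem_coe, Set.mem_ofPred_eq]
  rcases mem_edges.1 h with hb | hb
  · exact ⟨Or.inl hb, or_iff_not_imp_left.2 fun hc => ⟨hc, _, hb, ha.symm⟩⟩
  · exact ⟨or_iff_not_imp_left.2 fun hc => ⟨hc, _, hb, ha⟩, Or.inl hb⟩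

/-- Both half-spaces have the height-zero plane as boundary, and off the model the boundary
plaquettes are exactly the plaquettes of that plane. -/
theorem mem_bdryPlaquettes_iff {n : ℕ} {Q : Site → Prop}
    (side : (∀ x, Q x ↔ 0 ≤ x 2) ∨ ∀ x, Q x ↔ x 2 < 0) {e : Edge} (he : e ∉ edges n) :
    e ∈ bdryPlaquettes n ↔ ¬ (Q (tail e) ↔ Q (head e)) := by
  obtain ⟨x, i⟩ := e
  have hh : (x + Pi.single i 1 : Site) 2 = x 2 + if i = 2 then 1 else 0 := by
    simp [Pi.single_apply, eq_comm]
  rw [mem_edges, not_or] at he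
  simp only [bdryPlaquettes, Set.mem_ofPred_eq, he.2, not_false_eq_true, and_true]
  simp only [tail, head]
  rcases side with h | h <;> rw [h, h, hh] <;> split_ifs with hi <;>
    simp only [hi, true_and, false_and, false_iff, not_not] <;> omega

/-! ### Phase interfaces lie in the full interface -/

namespace IsPhase

variable {n : ℕ} {ω : Finset Edge} {Q : Site → Prop} {V : Set Site}

theorem mem_fill_iff (h : IsPhase n ω Q V) {x : Site} (hx : x ∉ box n) :
    x ∈ fill V ↔ x ∈ bdry n ∧ Q x :=
  (mem_fill_of_notMem_box (fun x hx hV => ((h.outside x hx).1 hV).1) hx).trans (h.outside x hx)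

/-- The interface of a phase is a part of the full interface. -/
theorem edgeBdry_subset (h : IsPhase n ω Q V) : edgeBdry n (fill V) ⊆ fullInterface n ω := by
  -- Adding the whole half-space outside the box makes the boundary of `S` off the model consist
  -- exactly of the boundary plaquettes. The leftover set `G` is then shown to be empty.
  set S : Set Site := fill V ∪ {x | x ∉ box n ∧ Q x} with hS
  have hSv : ∀ x ∈ verts n, x ∈ S ↔ x ∈ fill V := by
    intro x hx
    refine ⟨?_, Or.inl⟩
    rintro (hxf | ⟨hxb, hxQ⟩)
    · exact hxf
    · exact (h.mem_fill_iff hxb).2 ⟨hx.resolve_left hxb, hxQ⟩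
  have hSo : ∀ x, x ∉ box n → (x ∈ S ↔ Q x) := by
    intro x hx
    refine ⟨?_, fun hQ => Or.inr ⟨hx, hQ⟩⟩
    rintro (hxf | ⟨-, hxQ⟩)
    · exact ((h.mem_fill_iff hx).1 hxf).2
    · exact hxQ
  have hSe : ∀ e ∈ edges n, (Separates S e ↔ e ∈ edgeBdry n (fill V)) := by
    intro e he
    obtain ⟨h1, h2⟩ := mem_verts_of_mem_edges he
    rw [mem_edgeBdry, Separates, Separates, hSv _ h1, hSv _ h2]
    exact (and_iff_right he).symm
  have hSne : ∀ e, e ∉ edges n → (Separates S e ↔ e ∈ bdryPlaquettes n) := by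
    intro e he
    rw [mem_bdryPlaquettes_iff h.side he]
    rw [mem_edges, not_or] at he
    rw [Separates, hSo _ he.1, hSo _ he.2]
  obtain ⟨G, hGb, hG⟩ := exists_subset_box_separates (n := n) (ω := ω) (S := S) (by
    intro e he
    by_cases hen : e ∈ edges n
    · refine Or.inl (Finset.mem_sdiff.2 ⟨hen, h.closed e hen ?_⟩)
      exact (mem_edgeBdry.1 ((hSe e hen).1 he)).2.of_fill
    · exact Or.inr ((hSne e hen).1 he))
  have hGe : ∀ e, Separates G e → Separates (fill V) e := by
    intro e he
    obtain ⟨h1, -, h3⟩ := (hG e).1 he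
    have hen : e ∈ edges n := by
      by_contra hen
      exact h3 ((hSne e hen).1 h1)
    exact (mem_edgeBdry.1 ((hSe e hen).1 h1)).2
  have hadj : ∀ x y, lattice.Adj x y → (x ∈ fill V ↔ y ∈ fill V) → (x ∈ G ↔ y ∈ G) := by
    intro x y hxy hiff
    obtain ⟨i, rfl | rfl⟩ := lattice_adj.1 hxy
    · by_contra hc
      exact hGe (x, i) hc hiff
    · by_contra hc
      exact hGe (y, i) (fun hc' => hc hc'.symm) hiff.symm
  have hnotV : ∀ v ∈ V, v ∉ G := by
    intro v hv hvG
    obtain ⟨u, hu, hvu⟩ := h.joined v hv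
    refine hu (hGb ((iff_of_reachable (P := (· ∈ G)) hvu fun x y _ hxy => ?_).1 hvG))
    obtain ⟨ha, hx, hy⟩ := within_adj.1 hxy
    exact hadj x y ha (iff_of_true (subset_fill V hx) (subset_fill V hy))
  have hconst : ∀ v y, v ∉ V → (within Vᶜ).Reachable v y → (v ∈ G ↔ y ∈ G) := by
    intro v y hv hvy
    refine iff_of_reachable (P := (· ∈ G)) hvy fun a b hva hab => ?_
    refine hadj a b (within_adj.1 hab).1 ?_
    exact (mem_fill_iff_of_reachable hv hva).symm.trans
      (mem_fill_iff_of_reachable hv (hva.trans hab.reachable))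
  have hempty : ∀ v, v ∉ G := by
    intro v hvG
    by_cases hvV : v ∈ V
    · exact hnotV v hvV hvG
    by_cases hvf : v ∈ fill V
    · have hfin := (hvf.resolve_left hvV).2
      -- Above a highest site of the bubble lies a site of `V`. Both are in the filled phase, so `G`
      -- does not distinguish them, and `G` misses `V`.
      obtain ⟨y, hy, hmax⟩ := Set.exists_max_image _ (fun y : Site => y 2) hfin ⟨v, .refl v⟩
      have hyV := notMem_of_reachable_within_compl hvV hy
      have hya : lattice.Adj y (y + Pi.single 2 1) := lattice_adj.2 ⟨2, Or.inl rfl⟩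
      have hy1 : y + Pi.single 2 1 ∈ V := by
        by_contra hc
        have hr : (within Vᶜ).Reachable v (y + Pi.single 2 1) :=
          hy.trans (within_adj.2 ⟨hya, hyV, hc⟩ : (within Vᶜ).Adj _ _).reachable
        have := hmax _ hr
        simp at this
      refine hnotV _ hy1 ((hadj _ _ hya (iff_of_true ?_ (subset_fill V hy1))).1
        ((hconst v y hvV hy).1 hvG))
      exact (mem_fill_iff_of_reachable hvV hy).1 hvf
    -- An infinite component leaves the box, where `G` is empty.
    · have hinf : {y | (within Vᶜ).Reachable v y}.Infinite :=
        fun hfin => hvf (Or.inr ⟨hvV, hfin⟩)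
      obtain ⟨y, hy, hyb⟩ := hinf.exists_notMem_finset (box n)
      exact hyb (hGb ((hconst v y hvV hy).1 hvG))
  intro e he
  by_contra heI
  have hen := (mem_edgeBdry.1 he).1
  have hsep : Separates G e := (hG e).2
    ⟨(hSe e hen).2 he, heI, fun hb => notMem_edges_of_mem_bdryPlaquettes hb hen⟩
  exact hsep (iff_of_false (hempty _) (hempty _))

end IsPhase

/-! ### Columns -/

/-- The edge `e` is vertical and lies above the column `x`. -/
def InColumn (e : Edge) (x : ℤ × ℤ) : Prop := e.2 = 2 ∧ e.1 0 = x.1 ∧ e.1 1 = x.2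

theorem mem_columns {n : ℕ} {x : ℤ × ℤ} :
    x ∈ columns n ↔ (0 ≤ x.1 ∧ x.1 < n) ∧ 0 ≤ x.2 ∧ x.2 < n := by
  simp [columns]

theorem exists_step {P : ℤ → Prop} {a b : ℤ} (hab : a ≤ b) (h : ¬ (P a ↔ P b)) :
    ∃ t, a ≤ t ∧ t < b ∧ ¬ (P t ↔ P (t + 1)) := by
  by_contra! hc
  have : ∀ k : ℕ, a + k ≤ b → (P a ↔ P (a + k)) := by
    intro k
    induction k with
    | zero => simp
    | succ k ih =>
      intro hk
      push_cast at hk ⊢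
      rw [ih (by omega), ← add_assoc]
      exact hc _ (by omega) (by omega)
  have h2 := this (b - a).toNat (by omega)
  rw [show a + ((b - a).toNat : ℤ) = b by omega] at h2
  exact h h2

theorem vec_mem_box {n : ℕ} {a b t : ℤ} :
    (![a, b, t] : Site) ∈ box n ↔ (0 ≤ a ∧ a < n) ∧ (0 ≤ b ∧ b < n) ∧ 0 ≤ t ∧ t < n := by
  rw [mem_box, Fin.forall_fin_succ, Fin.forall_fin_two]
  rfl

theorem vec_neg_one_mem_bdry {n : ℕ} (hn : 1 ≤ n) {x : ℤ × ℤ} (hx : x ∈ columns n) :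
    (![x.1, x.2, -1] : Site) ∈ bdry n := by
  rw [mem_columns] at hx
  refine ⟨fun h => ?_, ![x.1, x.2, 0], vec_mem_box.2 ⟨hx.1, hx.2, by omega⟩,
    lattice_adj.2 ⟨2, Or.inl ?_⟩⟩
  · have := vec_mem_box.1 h
    omega
  · rw [vec_add_single_two]
    rfl

theorem vec_top_mem_bdry {n : ℕ} (hn : 1 ≤ n) {x : ℤ × ℤ} (hx : x ∈ columns n) :
    (![x.1, x.2, n] : Site) ∈ bdry n := by
  rw [mem_columns] at hx
  refine ⟨fun h => ?_, ![x.1, x.2, n - 1], vec_mem_box.2 ⟨hx.1, hx.2, by omega⟩,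
    lattice_adj.2 ⟨2, Or.inr ?_⟩⟩
  · have := vec_mem_box.1 h
    omega
  · rw [vec_add_single_two]
    simp

/-- An edge of a column of the box, separating a given set. -/
theorem exists_inColumn_separates {n : ℕ} {S : Set Site} {x : ℤ × ℤ} (hx : x ∈ columns n)
    {a b : ℤ} (ha : -1 ≤ a) (hab : a ≤ b) (hb : b ≤ n)
    (h : ¬ ((![x.1, x.2, a] : Site) ∈ S ↔ (![x.1, x.2, b] : Site) ∈ S)) :
    ∃ t, a ≤ t ∧ t < b ∧ ((![x.1, x.2, t] : Site), (2 : Fin 3)) ∈ edgeBdry n S := by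
  obtain ⟨t, hat, htb, ht⟩ := exists_step (P := fun t => (![x.1, x.2, t] : Site) ∈ S) hab h
  refine ⟨t, hat, htb, mem_edgeBdry.2 ⟨mem_edges.2 ?_, ?_⟩⟩
  · rw [mem_columns] at hx
    simp only [tail, head, vec_add_single_two, vec_mem_box]
    omega
  · rw [Separates, tail, head, vec_add_single_two]
    exact ht

/-- The column runs from a floor site to a ceiling site, exactly one of which belongs to the phase.
-/
theorem IsPhase.exists_inColumn {n : ℕ} {ω : Finset Edge} {Q : Site → Prop} {V : Set Site}
    (h : IsPhase n ω Q V) (hn : 1 ≤ n) {x : ℤ × ℤ} (hx : x ∈ columns n) :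
    ∃ e ∈ edgeBdry n (fill V), InColumn e x := by
  have h1 := vec_neg_one_mem_bdry hn hx
  have h2 := vec_top_mem_bdry hn hx
  obtain ⟨t, -, -, ht⟩ := exists_inColumn_separates (n := n) (S := fill V) hx (a := -1) (b := n)
    le_rfl (by omega) le_rfl (by
      rw [h.mem_fill_iff h1.1, h.mem_fill_iff h2.1]
      simp only [h1, h2, true_and]
      rcases h.side with hs | hs <;> simp [hs])
  exact ⟨_, ht, rfl, rfl, rfl⟩

/-- The line has half-integer horizontal coordinates, so it misses every vertical plaquette and
meets a horizontal one only through its centre. -/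
theorem columnPoint_mem_plaquette {x : ℤ × ℤ} {t : ℝ} {f : Edge} :
    columnPoint x t ∈ plaquette f ↔ InColumn f x ∧ t = f.1 2 + 1 := by
  obtain ⟨y, i⟩ := f
  have key : ∀ a b : ℤ, (b : ℝ) ≤ a + 1 / 2 ∧ (a : ℝ) + 1 / 2 ≤ b + 1 ↔ b = a := by
    intro a b
    constructor
    · rintro ⟨h1, h2⟩
      have h3 : (b : ℝ) < a + 1 := by linarith
      have h4 : (a : ℝ) < b + 1 := by linarith
      norm_cast at h3 h4
      omega
    · rintro rfl
      constructor <;> linarith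
  have hne : ∀ a b : ℤ, (a : ℝ) + 1 / 2 ≠ b + 1 := by
    intro a b h
    have h2 : ((2 * a + 1 : ℤ) : ℝ) = ((2 * b + 2 : ℤ) : ℝ) := by push_cast; linarith
    have := Int.cast_injective h2
    omega
  simp only [plaquette, Set.mem_ofPred_eq, InColumn]
  rw [Fin.forall_fin_succ, Fin.forall_fin_two]
  fin_cases i
  · simp [columnPoint]
    intro h
    exact absurd h (by simpa using hne x.1 (y 0))
  · simp [columnPoint]
    intro h
    exact absurd h (by simpa using hne x.2 (y 1))
  · have k0 := key x.1 (y 0)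
    have k1 := key x.2 (y 1)
    simp [columnPoint] at k0 k1 ⊢
    rw [k0, k1]
    tauto

theorem mem_above {I : Finset Edge} {x : ℤ × ℤ} {f : Edge} :
    f ∈ above I x ↔ f ∈ I ∧ InColumn f x := by
  simp only [above, Set.mem_ofPred_eq, columnPoint_mem_plaquette]
  exact and_congr_right fun _ => ⟨fun ⟨_, h, _⟩ => h, fun h => ⟨_, h, rfl⟩⟩

theorem heights_eq_image (I : Finset Edge) (x : ℤ × ℤ) :
    heights I x = (fun f : Edge => (f.1 2 : ℝ) + 1) '' above I x := by
  ext t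
  simp only [heights, Set.mem_ofPred_eq, columnPoint_mem_plaquette, Set.mem_image, mem_above]
  exact ⟨fun ⟨f, h1, h2, h3⟩ => ⟨f, ⟨h1, h2⟩, h3.symm⟩, fun ⟨f, ⟨h1, h2⟩, h3⟩ =>
    ⟨f, h1, h2, h3.symm⟩⟩

theorem InColumn.ext {x : ℤ × ℤ} {f g : Edge} (hf : InColumn f x) (hg : InColumn g x)
    (h : f.1 2 = g.1 2) : f = g := by
  obtain ⟨y, i⟩ := f
  obtain ⟨z, j⟩ := g
  obtain ⟨hf1, hf2, hf3⟩ := hf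
  obtain ⟨hg1, hg2, hg3⟩ := hg
  simp only at hf1 hf2 hf3 hg1 hg2 hg3 h
  rw [site_eq_vec y, site_eq_vec z, hf1, hf2, hf3, hg1, hg2, hg3, h]

/-- If the extreme heights above a column agree, at most one plaquette lies above it. -/
theorem above_subsingleton {I : Finset Edge} {x : ℤ × ℤ} (h : minHeight I x = maxHeight I x) :
    (above I x).Subsingleton := by
  intro f hf g hg
  have hfin : (heights I x).Finite := by
    rw [heights_eq_image]
    exact (I.finite_toSet.subset fun f hf => (mem_above.1 hf).1).image _
  have hall : ∀ f ∈ above I x, (f.1 2 : ℝ) + 1 = minHeight I x := by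
    intro f hf
    have hm : (f.1 2 : ℝ) + 1 ∈ heights I x := by
      rw [heights_eq_image]
      exact ⟨f, hf, rfl⟩
    exact le_antisymm (h ▸ le_csSup hfin.bddAbove hm) (csInf_le hfin.bddBelow hm)
  refine (mem_above.1 hf).2.ext (mem_above.1 hg).2 ?_
  have := (hall f hf).trans (hall g hg).symm
  exact_mod_cast add_right_cancel this

theorem extremes_eq_of_above {I : Finset Edge} {x : ℤ × ℤ} {f : Edge} (h : above I x = {f}) :
    minHeight I x = maxHeight I x := by
  simp [minHeight, maxHeight, heights_eq_image, h]


/-! ### Open phases and colour phases -/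

theorem openGraph_adj {ω : Finset Edge} {x y : Site} :
    (openGraph ω).Adj x y ↔ ∃ e ∈ ω, x = tail e ∧ y = head e ∨ y = tail e ∧ x = head e := by
  simp only [openGraph, SimpleGraph.fromRel_adj]
  constructor
  · rintro ⟨-, ⟨e, he, h⟩ | ⟨e, he, h⟩⟩
    exacts [⟨e, he, Or.inl h⟩, ⟨e, he, Or.inr h⟩]
  · rintro ⟨e, he, ⟨rfl, rfl⟩ | ⟨rfl, rfl⟩⟩
    · exact ⟨(lattice_adj_edge e).ne, Or.inl ⟨e, he, rfl, rfl⟩⟩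
    · exact ⟨(lattice_adj_edge e).ne.symm, Or.inr ⟨e, he, rfl, rfl⟩⟩

theorem openGraph_le_lattice (ω : Finset Edge) : openGraph ω ≤ lattice := by
  intro x y h
  obtain ⟨e, -, ⟨rfl, rfl⟩ | ⟨rfl, rfl⟩⟩ := openGraph_adj.1 h
  exacts [lattice_adj_edge e, (lattice_adj_edge e).symm]

theorem openGraph_adj_of_mem {ω : Finset Edge} {e : Edge} (he : e ∈ ω) :
    (openGraph ω).Adj (tail e) (head e) :=
  openGraph_adj.2 ⟨e, he, Or.inl ⟨rfl, rfl⟩⟩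

theorem mem_verts_of_openGraph_adj {n : ℕ} {ω : Finset Edge} (hω : ω ⊆ edges n) {x y : Site}
    (h : (openGraph ω).Adj x y) : x ∈ verts n ∧ y ∈ verts n := by
  obtain ⟨e, he, ⟨rfl, rfl⟩ | ⟨rfl, rfl⟩⟩ := openGraph_adj.1 h
  exacts [mem_verts_of_mem_edges (hω he), (mem_verts_of_mem_edges (hω he)).symm]

theorem mem_verts_of_reachable {G : SimpleGraph Site} {n : ℕ}
    (hG : ∀ x y, G.Adj x y → y ∈ verts n) {x y : Site} (hx : x ∈ verts n)
    (h : G.Reachable x y) : y ∈ verts n := by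
  rw [SimpleGraph.reachable_iff_reflTransGen] at h
  cases h with
  | refl => exact hx
  | tail _ h => exact hG _ _ h

/-- A cluster grown from `B` is joined to `B` within itself. -/
theorem exists_reachable_within {G : SimpleGraph Site} (hG : G ≤ lattice) {B : Set Site}
    {v : Site} (hv : ∃ u ∈ B, G.Reachable u v) :
    ∃ u ∈ B, (within {v | ∃ u ∈ B, G.Reachable u v}).Reachable v u := by
  obtain ⟨u, hu, huv⟩ := hv
  refine ⟨u, hu, SimpleGraph.Reachable.symm ?_⟩
  refine (iff_of_reachable (P := fun y => (within _).Reachable u y) huv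
    fun a b hua hab => ?_).1 .rfl
  have : (within {v | ∃ u ∈ B, G.Reachable u v}).Adj a b :=
    within_adj.2 ⟨hG hab, ⟨u, hu, hua⟩, u, hu, hua.trans hab.reachable⟩
  exact ⟨fun h => h.trans this.reachable, fun h => h.trans this.symm.reachable⟩

theorem isPhase_openPhase {n : ℕ} {ω : Finset Edge} {Q : Site → Prop} (hω : ω ⊆ edges n)
    (side : (∀ x, Q x ↔ 0 ≤ x 2) ∨ ∀ x, Q x ↔ x 2 < 0)
    (hdisc : ∀ x ∈ bdry n, Q x → ∀ y ∈ bdry n, ¬ Q y → ¬ (openGraph ω).Reachable x y) :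
    IsPhase n ω Q (openPhase ω {x ∈ bdry n | Q x}) where
  side := side
  outside x hx := by
    constructor
    · rintro ⟨u, ⟨hu, hQu⟩, hux⟩
      have hxv := mem_verts_of_reachable
        (fun x y h => (mem_verts_of_openGraph_adj hω h).2) (Or.inr hu) hux
      have hxb : x ∈ bdry n := hxv.resolve_left hx
      refine ⟨hxb, ?_⟩
      by_contra hQ
      exact hdisc u hu hQu x hxb hQ hux
    · exact fun h => ⟨x, h, .rfl⟩
  closed e _ hs he := by
    have ha := (openGraph_adj_of_mem he).reachable
    exact hs ⟨fun ⟨u, hu, h⟩ => ⟨u, hu, h.trans ha⟩, fun ⟨u, hu, h⟩ => ⟨u, hu, h.trans ha.symm⟩⟩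
  joined v hv := by
    obtain ⟨u, hu, h⟩ := exists_reachable_within (openGraph_le_lattice ω) hv
    exact ⟨u, hu.1.1, h⟩

/-- Open edges are monochromatic, so an open edge of the model with one endpoint in the phase has
both. On the boundary, colour `c` occurs only on the side `Q`, so the phase cannot reach the other
side. -/
theorem isPhase_colourPhase {n : ℕ} {ω : Finset Edge} {σ : box n → ℕ} {c : ℕ} {Q : Site → Prop}
    (side : (∀ x, Q x ↔ 0 ≤ x 2) ∨ ∀ x, Q x ↔ x 2 < 0)
    (hQ : ∀ x, x ∉ box n → (extend n σ x = c ↔ Q x))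
    (hσ : ∀ e ∈ ω, extend n σ (tail e) = extend n σ (head e)) :
    IsPhase n ω Q (colourPhase n σ c {x ∈ bdry n | Q x}) := by
  have hsub : ∀ v ∈ colourPhase n σ c {x ∈ bdry n | Q x}, v ∈ verts n ∧ extend n σ v = c := by
    rintro v ⟨u, ⟨hu, hQu⟩, huv⟩
    refine (iff_of_reachable (P := fun y => y ∈ verts n ∧ extend n σ y = c) huv
      fun a b _ hab => ?_).1 ⟨Or.inr hu, (hQ u hu.1).2 hQu⟩
    exact iff_of_true (within_adj.1 hab).2.1 (within_adj.1 hab).2.2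
  refine ⟨side, fun x hx => ⟨fun h => ?_, fun h => ⟨x, h, .rfl⟩⟩, fun e hen hs he => hs ?_,
    fun v hv => ?_⟩
  · obtain ⟨h1, h2⟩ := hsub x h
    exact ⟨h1.resolve_left hx, (hQ x hx).1 h2⟩
  · obtain ⟨h1, h2⟩ := mem_verts_of_mem_edges hen
    have hstep : extend n σ (tail e) = c →
        (within {x ∈ verts n | extend n σ x = c}).Reachable (tail e) (head e) := fun hc =>
      (within_adj.2 ⟨lattice_adj_edge e, ⟨h1, hc⟩, h2, (hσ e he).symm.trans hc⟩ :
        (within {x ∈ verts n | extend n σ x = c}).Adj _ _).reachable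
    constructor
    · intro h
      have := hstep (hsub _ h).2
      obtain ⟨u, hu, hr⟩ := h
      exact ⟨u, hu, hr.trans this⟩
    · intro h
      have := hstep ((hσ e he).trans (hsub _ h).2)
      obtain ⟨u, hu, hr⟩ := h
      exact ⟨u, hu, hr.trans this.symm⟩
  · obtain ⟨u, hu, h⟩ := exists_reachable_within
      (G := within {x ∈ verts n | extend n σ x = c}) (fun x y h => (within_adj.1 h).1) hv
    exact ⟨u, hu.1.1, h⟩

theorem isPhase_top {n : ℕ} {ω : Finset Edge} (hω : ω ⊆ edges n) (hd : Disconnected n ω) :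
    IsPhase n ω (fun x => 0 ≤ x 2) (openPhase ω (redBdry n)) :=
  isPhase_openPhase hω (Or.inl fun _ => Iff.rfl)
    fun x hx hQ y hy hQy => hd x ⟨hx, hQ⟩ y ⟨hy, not_le.1 hQy⟩

theorem isPhase_bot {n : ℕ} {ω : Finset Edge} (hω : ω ⊆ edges n) (hd : Disconnected n ω) :
    IsPhase n ω (fun x => x 2 < 0) (openPhase ω (blueBdry n)) :=
  isPhase_openPhase hω (Or.inr fun _ => Iff.rfl)
    fun x hx hQ y hy hQy h => hd y ⟨hy, not_lt.1 hQy⟩ x ⟨hx, hQ⟩ h.symm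

theorem isPhase_red {n : ℕ} {ω : Finset Edge} {σ : box n → ℕ}
    (hσ : ∀ e ∈ ω, extend n σ (tail e) = extend n σ (head e)) :
    IsPhase n ω (fun x => 0 ≤ x 2) (colourPhase n σ 2 (redBdry n)) :=
  isPhase_colourPhase (Or.inl fun _ => Iff.rfl) (fun x hx => by simp [extend, hx]) hσ

theorem isPhase_blue {n : ℕ} {ω : Finset Edge} {σ : box n → ℕ}
    (hσ : ∀ e ∈ ω, extend n σ (tail e) = extend n σ (head e)) :
    IsPhase n ω (fun x => x 2 < 0) (colourPhase n σ 1 (blueBdry n)) :=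
  isPhase_colourPhase (Or.inr fun _ => Iff.rfl) (fun x hx => by simp [extend, hx]) hσ

/-! ### Pairs of positive probability and single-plaquette columns -/

open Classical in
theorem exists_of_jointProb_pos {n q : ℕ} {p : ℝ} {A : Set (Finset Edge × (box n → ℕ))}
    (h : 0 < jointProb n p q A) : ∃ z ∈ A, z ∈ pairs n q ∧ jointWeight n p z ≠ 0 := by
  unfold jointProb at h
  rw [div_eq_mul_inv] at h
  obtain ⟨z, hz, hw⟩ := Finset.exists_ne_zero_of_sum_ne_zero (left_ne_zero_of_mul h.ne')
  rw [Finset.mem_filter] at hz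
  exact ⟨z, hz.2, hz.1, hw⟩

theorem compatible_of_jointProb_pos {n q : ℕ} {p : ℝ} {ω : Finset Edge} {σ : box n → ℕ}
    (h : 0 < jointProb n p q {(ω, σ)}) :
    ω ⊆ edges n ∧ ∀ e ∈ ω, extend n σ (tail e) = extend n σ (head e) := by
  obtain ⟨z, rfl, hz, hw⟩ := exists_of_jointProb_pos h
  refine ⟨Finset.mem_powerset.1 (Finset.mem_product.1 hz).1, fun e he => ?_⟩
  by_contra hc
  exact hw (mul_eq_zero_of_right _ (Finset.prod_eq_zero he (if_neg hc)))

theorem disconnected_of_compatible {n : ℕ} {ω : Finset Edge} {σ : box n → ℕ}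
    (hσ : ∀ e ∈ ω, extend n σ (tail e) = extend n σ (head e)) : Disconnected n ω := by
  intro x hx y hy hxy
  have := (iff_of_reachable (P := fun z => extend n σ z = 2) hxy fun a b _ hab => ?_).1
    (by simp [extend, hx.1.1, hx.2])
  · simp [extend, hy.1.1, hy.2] at this
  · obtain ⟨e, he, ⟨rfl, rfl⟩ | ⟨rfl, rfl⟩⟩ := openGraph_adj.1 hab <;> simp only [hσ e he]

theorem above_eq_singleton {n : ℕ} {ω : Finset Edge} {Q : Site → Prop} {V : Set Site}
    (h : IsPhase n ω Q V) (hn : 1 ≤ n) {x : ℤ × ℤ} (hx : x ∈ columns n) {f : Edge}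
    (hf : above (fullInterface n ω) x = {f}) : above (edgeBdry n (fill V)) x = {f} := by
  obtain ⟨e, he, hec⟩ := h.exists_inColumn hn hx
  have hsub : ∀ g ∈ above (edgeBdry n (fill V)) x, g = f := fun g hg => by
    obtain ⟨hg1, hg2⟩ := mem_above.1 hg
    have : g ∈ above (fullInterface n ω) x := mem_above.2 ⟨h.edgeBdry_subset hg1, hg2⟩
    rwa [hf] at this
  refine Set.eq_singleton_iff_unique_mem.2 ⟨?_, hsub⟩
  have hea : e ∈ above (edgeBdry n (fill V)) x := mem_above.2 ⟨he, hec⟩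
  exact hsub e hea ▸ hea

theorem exists_above {n : ℕ} {ω : Finset Edge} (hω : ω ⊆ edges n) (hd : Disconnected n ω)
    (hn : 1 ≤ n) {x : ℤ × ℤ} (hx : x ∈ columns n) : ∃ f, f ∈ above (fullInterface n ω) x := by
  obtain ⟨e, he, hec⟩ := (isPhase_top hω hd).exists_inColumn hn hx
  exact ⟨e, mem_above.2 ⟨(isPhase_top hω hd).edgeBdry_subset he, hec⟩⟩

/-- A column with equal extreme heights has a single plaquette of each of the interfaces. -/
theorem exists_common_plaquette {n : ℕ} {ω : Finset Edge} {σ : box n → ℕ} (hω : ω ⊆ edges n)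
    (hσ : ∀ e ∈ ω, extend n σ (tail e) = extend n σ (head e)) (hn : 1 ≤ n) {x : ℤ × ℤ}
    (hx : x ∈ columns n)
    (h : minHeight (fullInterface n ω) x = maxHeight (fullInterface n ω) x) :
    ∃ f : Edge,
      above (fullInterface n ω) x = {f} ∧
      above (botInterface n ω) x = {f} ∧
      above (blueInterface n σ) x = {f} ∧
      above (redInterface n σ) x = {f} ∧
      above (topInterface n ω) x = {f} := by
  have hd := disconnected_of_compatible hσ
  obtain ⟨f, hf⟩ := exists_above hω hd hn hx
  have hfx : above (fullInterface n ω) x = {f} :=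
    Set.eq_singleton_iff_unique_mem.2 ⟨hf, fun g hg => above_subsingleton h hg hf⟩
  exact ⟨f, hfx, above_eq_singleton (isPhase_bot hω hd) hn hx hfx,
    above_eq_singleton (isPhase_blue hσ) hn hx hfx,
    above_eq_singleton (isPhase_red hσ) hn hx hfx,
    above_eq_singleton (isPhase_top hω hd) hn hx hfx⟩

-- Distinct columns use disjoint sets of plaquettes. Each contributes one, and a column with a
-- single plaquette has equal extreme heights, so unequal heights force a second.
open Classical in
theorem card_columns_add_le {n : ℕ} {I : Finset Edge}
    (hI : ∀ x ∈ columns n, ∃ f, f ∈ above I x) :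
    n ^ 2 + {x ∈ columns n | minHeight I x ≠ maxHeight I x}.card ≤ I.card := by
  have hcol : (columns n).card = n ^ 2 := by simp [columns, sq]
  have hdisj : (columns n : Set (ℤ × ℤ)).PairwiseDisjoint
      fun x => I.filter fun f => InColumn f x := by
    intro x _ y _ hxy
    refine Finset.disjoint_left.2 fun f hf hf' => hxy ?_
    obtain ⟨-, -, h1, h2⟩ := Finset.mem_filter.1 hf
    obtain ⟨-, -, h3, h4⟩ := Finset.mem_filter.1 hf'
    exact Prod.ext (h1.symm.trans h3) (h2.symm.trans h4)
  have hge : ∀ x ∈ columns n, 1 + (if minHeight I x ≠ maxHeight I x then 1 else 0) ≤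
      (I.filter fun f => InColumn f x).card := by
    intro x hx
    obtain ⟨f, hf⟩ := hI x hx
    have hf' : f ∈ I.filter fun f => InColumn f x := Finset.mem_filter.2 (mem_above.1 hf)
    split_ifs with h
    · by_contra hc
      refine h (extremes_eq_of_above (f := f) (Set.eq_singleton_iff_unique_mem.2
        ⟨hf, fun g hg => ?_⟩))
      exact Finset.card_le_one.1 (by omega) g (Finset.mem_filter.2 (mem_above.1 hg)) f hf'
    · exact Finset.card_pos.2 ⟨f, hf'⟩
  calc n ^ 2 + {x ∈ columns n | minHeight I x ≠ maxHeight I x}.card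
      = ∑ x ∈ columns n, (1 + if minHeight I x ≠ maxHeight I x then 1 else 0) := by
        rw [Finset.sum_add_distrib, Finset.card_filter]
        simp [hcol]
    _ ≤ ∑ x ∈ columns n, (I.filter fun f => InColumn f x).card := Finset.sum_le_sum hge
    _ = ((columns n).biUnion fun x => I.filter fun f => InColumn f x).card :=
        (Finset.card_biUnion hdisj).symm
    _ ≤ I.card := Finset.card_le_card
        (Finset.biUnion_subset.2 fun x _ => Finset.filter_subset _ _)


/-! ### Clusters touched by the full interface -/

theorem wiredGraph_adj {n : ℕ} {ω : Finset Edge} {x y : Site} :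
    (wiredGraph n ω).Adj x y ↔ (openGraph ω).Adj x y ∨ x ≠ y ∧
      ((x ∈ redBdry n ∧ y ∈ redBdry n) ∨ (x ∈ blueBdry n ∧ y ∈ blueBdry n)) := by
  simp only [wiredGraph, SimpleGraph.sup_adj, SimpleGraph.fromRel_adj]
  tauto

theorem openGraph_mono {ω ω' : Finset Edge} (h : ω ⊆ ω') : openGraph ω ≤ openGraph ω' := by
  intro x y hxy
  obtain ⟨e, he, h'⟩ := openGraph_adj.1 hxy
  exact openGraph_adj.2 ⟨e, h he, h'⟩

theorem wiredGraph_mono (n : ℕ) {ω ω' : Finset Edge} (h : ω ⊆ ω') :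
    wiredGraph n ω ≤ wiredGraph n ω' :=
  sup_le_sup_right (openGraph_mono h) _

theorem redBdry_subset (n : ℕ) : redBdry n ⊆ verts n := fun _ h => Or.inr h.1

theorem blueBdry_subset (n : ℕ) : blueBdry n ⊆ verts n := fun _ h => Or.inr h.1

theorem mem_verts_of_wiredGraph_adj {n : ℕ} {ω : Finset Edge} (hω : ω ⊆ edges n) {x y : Site}
    (h : (wiredGraph n ω).Adj x y) : y ∈ verts n := by
  rcases wiredGraph_adj.1 h with h | ⟨-, h | h⟩
  exacts [(mem_verts_of_openGraph_adj hω h).2, redBdry_subset n h.2, blueBdry_subset n h.2]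

theorem verts_finite (n : ℕ) : (verts n).Finite := by
  refine (Set.finite_Icc (fun _ => -1 : Site) (fun _ => (n : ℤ))).subset ?_
  rintro x (hx | hx)
  · have := mem_box.1 hx
    exact ⟨fun j => (show (-1 : ℤ) ≤ x j by linarith [(this j).1]), fun j => (this j).2.le⟩
  · exact ⟨fun j => (apply_bounds_of_mem_bdry hx j).1, fun j => (apply_bounds_of_mem_bdry hx j).2⟩

/-- The clusters counted by `clusterCount`. -/
def clusters (n : ℕ) (ω : Finset Edge) : Set (wiredGraph n ω).ConnectedComponent :=
  (wiredGraph n ω).connectedComponentMk '' verts n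

theorem clusters_finite (n : ℕ) (ω : Finset Edge) : (clusters n ω).Finite :=
  (verts_finite n).image _

theorem clusterCount_anti (n : ℕ) {ω ω' : Finset Edge} (h : ω ⊆ ω') :
    clusterCount n ω' ≤ clusterCount n ω := by
  have : clusters n ω' = SimpleGraph.ConnectedComponent.map
      (SimpleGraph.Hom.ofLE (wiredGraph_mono n h)) '' clusters n ω := by
    rw [clusters, clusters, Set.image_image]
    rfl
  change (clusters n ω').ncard ≤ (clusters n ω).ncard
  rw [this]
  exact Set.ncard_image_le (clusters_finite n ω)

/-- The clusters separated from their complement by some edge of `I`. -/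
def touchedClusters (n : ℕ) (ω I : Finset Edge) : Set (wiredGraph n ω).ConnectedComponent :=
  {A ∈ clusters n ω | ∃ e ∈ I, Separates A.supp e}

/-- A cluster that no edge of `I` separates stays a full cluster after `I` is opened, so the
untouched clusters map injectively to the new ones. -/
theorem clusterCount_le_add_touched (n : ℕ) (ω I : Finset Edge) :
    clusterCount n ω ≤ clusterCount n (ω ∪ I) + (touchedClusters n ω I).ncard := by
  set U : Set (wiredGraph n ω).ConnectedComponent := clusters n ω \ touchedClusters n ω I with hU
  have hle := wiredGraph_mono n (Finset.subset_union_left : ω ⊆ ω ∪ I)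
  have hUcard : U.ncard ≤ clusterCount n (ω ∪ I) := by
    refine Set.ncard_le_ncard_of_injOn
      (SimpleGraph.ConnectedComponent.map (SimpleGraph.Hom.ofLE hle)) ?_ ?_
      (clusters_finite n (ω ∪ I))
    · rintro _ ⟨⟨x, hx, rfl⟩, -⟩
      exact ⟨x, hx, rfl⟩
    · rintro _ ⟨⟨x, hx, rfl⟩, hxt⟩ _ ⟨⟨y, hy, rfl⟩, -⟩ hxy
      have hr : (wiredGraph n (ω ∪ I)).Reachable x y := SimpleGraph.ConnectedComponent.exact hxy
      set A := (wiredGraph n ω).connectedComponentMk x with hA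
      have hIe : ∀ e ∈ I, (tail e ∈ A.supp ↔ head e ∈ A.supp) := by
        intro e he
        by_contra hc
        exact hxt ⟨⟨x, hx, rfl⟩, e, he, hc⟩
      have hstep : ∀ u v, (wiredGraph n ω).Adj u v → (u ∈ A.supp ↔ v ∈ A.supp) := by
        intro u v huv
        simp only [SimpleGraph.ConnectedComponent.mem_supp_iff,
          SimpleGraph.ConnectedComponent.sound huv.reachable]
      have hy' := (iff_of_reachable (P := (· ∈ A.supp)) hr fun u v _ huv => ?_).1 rfl
      · exact (hy' : _ = A).symm
      rcases wiredGraph_adj.1 huv with h | h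
      · obtain ⟨e, he, h'⟩ := openGraph_adj.1 h
        rcases Finset.mem_union.1 he with he | he
        · exact hstep u v (wiredGraph_adj.2 (Or.inl (openGraph_adj.2 ⟨e, he, h'⟩)))
        · rcases h' with ⟨rfl, rfl⟩ | ⟨rfl, rfl⟩
          exacts [hIe e he, (hIe e he).symm]
      · exact hstep u v (wiredGraph_adj.2 (Or.inr h))
  have hsub : clusters n ω ⊆ U ∪ touchedClusters n ω I := by
    intro A hA
    by_cases h : A ∈ touchedClusters n ω I
    exacts [Or.inr h, Or.inl ⟨hA, h⟩]
  have hfin : (U ∪ touchedClusters n ω I).Finite :=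
    (clusters_finite n ω).subset (Set.union_subset Set.sdiff_subset fun _ h => h.1)
  calc clusterCount n ω ≤ (U ∪ touchedClusters n ω I).ncard := Set.ncard_le_ncard hsub hfin
    _ ≤ U.ncard + (touchedClusters n ω I).ncard := Set.ncard_union_le _ _
    _ ≤ _ := Nat.add_le_add_right hUcard _

theorem not_iff_not_iff_comm (a b c d : Prop) :
    ¬ (¬ (a ↔ b) ↔ ¬ (c ↔ d)) ↔ ¬ (¬ (a ↔ c) ↔ ¬ (b ↔ d)) := by
  by_cases a <;> by_cases b <;> by_cases c <;> by_cases d <;> simp [*]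

/-- The full interface meets the edge boundary of a cluster in the box in at least two edges, or
not at all. -/
theorem exists_ne_separates {n : ℕ} {ω : Finset Edge} {S : Set Site} (hSb : S ⊆ box n)
    (hS : ∀ e, Separates S e → e ∉ ω) (ht : ∃ e ∈ fullInterface n ω, Separates S e) :
    ∃ e ∈ fullInterface n ω, ∃ f ∈ fullInterface n ω,
      e ≠ f ∧ Separates S e ∧ Separates S f := by
  have hSe : ∀ e, Separates S e → e ∈ edges n := by
    intro e he
    rw [mem_edges]
    by_contra! hc
    exact he (iff_of_false (fun h => hc.1 (hSb h)) (fun h => hc.2 (hSb h)))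
  obtain ⟨G, hGb, hG⟩ := exists_subset_box_separates (n := n) (ω := ω) (S := S)
    fun e he => Or.inl (Finset.mem_sdiff.2 ⟨hSe e he, hS e he⟩)
  -- The edge boundary of the symmetric difference of `S` and `G` is exactly the part of the
  -- boundary of `S` on the full interface. A vertical line through a point of this bounded set
  -- crosses that boundary once below the point and once above.
  set H : Set Site := {x | ¬ (x ∈ S ↔ x ∈ G)} with hH
  have hHb : H ⊆ box n := by
    intro x hx
    by_contra hb
    exact hx (iff_of_false (fun h => hb (hSb h)) (fun h => hb (hGb h)))
  have hHs : ∀ e, Separates H e ↔ Separates S e ∧ e ∈ fullInterface n ω := by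
    intro e
    have h1 : Separates H e ↔ ¬ (Separates S e ↔ Separates G e) := by
      exact not_iff_not_iff_comm _ _ _ _
    have h2 : Separates S e → e ∉ bdryPlaquettes n :=
      fun h hb => notMem_edges_of_mem_bdryPlaquettes hb (hSe e h)
    rw [h1, hG]
    by_cases hs : Separates S e
    · simp [hs, h2 hs]
    · simp [hs]
  obtain ⟨e, he, hes⟩ := ht
  have heH := (hHs e).2 ⟨hes, he⟩
  obtain ⟨y, hy⟩ : ∃ y, y ∈ H := by
    by_contra! hc
    exact heH (iff_of_false (hc _) (hc _))
  have hyb := mem_box.1 (hHb hy)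
  have hyH : (![y 0, y 1, y 2] : Site) ∈ H := site_eq_vec y ▸ hy
  have hcol : (y 0, y 1) ∈ columns n := mem_columns.2 ⟨hyb 0, hyb 1⟩
  have h0 : (![y 0, y 1, -1] : Site) ∉ H := fun h => by
    have := vec_mem_box.1 (hHb h)
    omega
  have h1 : (![y 0, y 1, n] : Site) ∉ H := fun h => by
    have := vec_mem_box.1 (hHb h)
    omega
  have hy2 := hyb 2
  obtain ⟨s, -, hs, hse⟩ := exists_inColumn_separates (S := H) hcol (a := -1) (b := y 2) le_rfl
    (by omega) (by omega) (fun h => h0 (h.2 hyH))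
  obtain ⟨t, ht, -, hte⟩ := exists_inColumn_separates (S := H) hcol (a := y 2) (b := n) (by omega)
    (by omega) le_rfl (fun h => h1 (h.1 hyH))
  have hs' := (hHs _).1 (mem_edgeBdry.1 hse).2
  have ht' := (hHs _).1 (mem_edgeBdry.1 hte).2
  refine ⟨_, hs'.2, _, ht'.2, fun h => ?_, hs'.1, ht'.1⟩
  have := congrFun (congrArg Prod.fst h) 2
  simp at this
  omega

/-- An endpoint of an edge. -/
def endpoint (e : Edge) (b : Bool) : Site := if b then tail e else head e

theorem Separates.exists_endpoint {S : Set Site} {e : Edge} (h : Separates S e) :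
    ∃ b, endpoint e b ∈ S := by
  by_contra! hc
  exact h (iff_of_false (hc true) (hc false))

theorem connectedComponentMk_eq_of_openPhase {n : ℕ} {ω : Finset Edge} {B : Set Site}
    (hB : ∀ x ∈ B, ∀ y ∈ B, x ≠ y → (wiredGraph n ω).Adj x y) {u v : Site} (hu : u ∈ B)
    (hv : v ∈ openPhase ω B) :
    (wiredGraph n ω).connectedComponentMk v = (wiredGraph n ω).connectedComponentMk u := by
  obtain ⟨w, hw, hwv⟩ := hv
  have h1 : (wiredGraph n ω).Reachable w v := hwv.mono le_sup_left
  refine SimpleGraph.ConnectedComponent.sound (h1.symm.trans ?_)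
  rcases eq_or_ne w u with rfl | hne
  exacts [.rfl, (hB w hw u hu hne).reachable]

open Classical in
/-- Every phase cluster has an endpoint of an interface plaquette in each column. -/
theorem sq_le_card_endpoints {n : ℕ} (hn : 1 ≤ n) {ω : Finset Edge} {Q : Site → Prop}
    {V : Set Site} (h : IsPhase n ω Q V) {P : Edge × Bool → Prop}
    (hP : ∀ z, endpoint z.1 z.2 ∈ V → P z) :
    n ^ 2 ≤ ((fullInterface n ω ×ˢ Finset.univ).filter P).card := by
  have hex : ∀ x : ℤ × ℤ, ∃ z : Edge × Bool, x ∈ columns n →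
      z.1 ∈ fullInterface n ω ∧ InColumn z.1 x ∧ endpoint z.1 z.2 ∈ V := by
    intro x
    by_cases hx : x ∈ columns n
    · obtain ⟨e, he, hec⟩ := h.exists_inColumn hn hx
      obtain ⟨b, hb⟩ := (mem_edgeBdry.1 he).2.of_fill.exists_endpoint
      exact ⟨(e, b), fun _ => ⟨h.edgeBdry_subset he, hec, hb⟩⟩
    · exact ⟨default, fun h => absurd h hx⟩
  choose z hz using hex
  have hcol : (columns n).card = n ^ 2 := by simp [columns, sq]
  rw [← hcol]
  refine Finset.card_le_card_of_injOn z (fun x hx => ?_) (fun x hx y hy hxy => ?_)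
  · obtain ⟨h1, -, h3⟩ := hz x hx
    simp only [Finset.coe_filter, Finset.mem_product, Finset.mem_univ, and_true,
      Set.mem_ofPred_eq]
    exact ⟨h1, hP _ h3⟩
  · obtain ⟨-, ⟨-, h1, h2⟩, -⟩ := hz x hx
    obtain ⟨-, ⟨-, h3, h4⟩, -⟩ := hz y hy
    rw [hxy] at h1 h2
    exact Prod.ext (h1.symm.trans h3) (h2.symm.trans h4)

open Classical in
/-- The number of clusters touched by the full interface is at most its excess area plus two. -/
theorem ncard_touched_add_le {n : ℕ} (hn : 1 ≤ n) {ω : Finset Edge} (hω : ω ⊆ edges n)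
    (hd : Disconnected n ω) :
    (touchedClusters n ω (fullInterface n ω)).ncard + n ^ 2 ≤ (fullInterface n ω).card + 2 := by
  set I := fullInterface n ω with hI
  have h00 : ((0, 0) : ℤ × ℤ) ∈ columns n := by rw [mem_columns]; simp; omega
  set r : Site := ![0, 0, n]
  set b : Site := ![0, 0, -1]
  have hr : r ∈ redBdry n := ⟨vec_top_mem_bdry hn h00, by simp [r]⟩
  have hb : b ∈ blueBdry n := ⟨vec_neg_one_mem_bdry hn h00, by simp [b]⟩
  set mk := (wiredGraph n ω).connectedComponentMk with hmk
  have hred : ∀ v ∈ openPhase ω (redBdry n), mk v = mk r := fun v hv =>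
    connectedComponentMk_eq_of_openPhase
      (fun x hx y hy hxy => wiredGraph_adj.2 (Or.inr ⟨hxy, Or.inl ⟨hx, hy⟩⟩)) hr hv
  have hblue : ∀ v ∈ openPhase ω (blueBdry n), mk v = mk b := fun v hv =>
    connectedComponentMk_eq_of_openPhase
      (fun x hx y hy hxy => wiredGraph_adj.2 (Or.inr ⟨hxy, Or.inr ⟨hx, hy⟩⟩)) hb hv
  have hrb : mk r ≠ mk b := by
    intro h
    have hreach : (wiredGraph n ω).Reachable r b := SimpleGraph.ConnectedComponent.exact h
    have hmem := (iff_of_reachable (P := (· ∈ openPhase ω (redBdry n))) hreach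
      fun u v _ huv => ?_).1 ⟨r, hr, .rfl⟩
    · obtain ⟨u, hu, hub⟩ := hmem
      exact hd u hu b hb hub
    · rcases wiredGraph_adj.1 huv with h | ⟨-, h | h⟩
      · exact ⟨fun ⟨w, hw, h'⟩ => ⟨w, hw, h'.trans h.reachable⟩,
          fun ⟨w, hw, h'⟩ => ⟨w, hw, h'.trans h.symm.reachable⟩⟩
      · exact iff_of_true ⟨u, h.1, .rfl⟩ ⟨v, h.2, .rfl⟩
      · exact iff_of_false (fun ⟨w, hw, h'⟩ => hd w hw u h.1 h')
          (fun ⟨w, hw, h'⟩ => hd w hw v h.2 h')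
  have hfin : (touchedClusters n ω I).Finite := (clusters_finite n ω).subset fun _ h => h.1
  -- The touched clusters other than the two wired ones. They avoid the boundary of the box, so each
  -- takes at least two of the 2|I| endpoints while each wired cluster takes n²: 2n² + 2|T| ≤ 2|I|.
  set T := (hfin.toFinset.erase (mk r)).erase (mk b) with hT
  set fib : (wiredGraph n ω).ConnectedComponent → Finset (Edge × Bool) := fun A =>
    (I ×ˢ Finset.univ).filter fun z => mk (endpoint z.1 z.2) = A with hfib
  have hTcard : (touchedClusters n ω I).ncard ≤ T.card + 2 := by
    rw [Set.ncard_eq_toFinset_card _ hfin, hT]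
    have h1 := Finset.pred_card_le_card_erase (s := hfin.toFinset) (a := mk r)
    have h2 := Finset.pred_card_le_card_erase (s := hfin.toFinset.erase (mk r)) (a := mk b)
    omega
  have hfibT : ∀ A ∈ T, 2 ≤ (fib A).card := by
    intro A hA
    simp only [hT, Finset.mem_erase, Set.Finite.mem_toFinset] at hA
    obtain ⟨hAb, hAr, ⟨v, hv, hvA⟩, ht⟩ := hA
    have hverts : A.supp ⊆ verts n := by
      intro y hy
      have hy' : mk v = mk y := hvA.trans (hy : mk y = A).symm
      exact mem_verts_of_reachable (fun x y h => mem_verts_of_wiredGraph_adj hω h) hv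
        (SimpleGraph.ConnectedComponent.exact hy')
    have hbox : A.supp ⊆ box n := by
      intro y hy
      refine (hverts hy).resolve_right fun hyb => ?_
      rcases le_or_gt 0 (y 2) with h0 | h0
      · exact hAr ((hy : mk y = A).symm.trans (hred y ⟨y, ⟨hyb, h0⟩, .rfl⟩))
      · exact hAb ((hy : mk y = A).symm.trans (hblue y ⟨y, ⟨hyb, h0⟩, .rfl⟩))
    have hclosed : ∀ e, Separates A.supp e → e ∉ ω := by
      intro e hs he
      have hadj : (wiredGraph n ω).Adj (tail e) (head e) :=
        wiredGraph_adj.2 (Or.inl (openGraph_adj_of_mem he))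
      refine hs ?_
      simp only [SimpleGraph.ConnectedComponent.mem_supp_iff,
        SimpleGraph.ConnectedComponent.sound hadj.reachable]
    obtain ⟨e, he, f, hf, hef, hse, hsf⟩ := exists_ne_separates hbox hclosed ht
    obtain ⟨be, hbe⟩ := hse.exists_endpoint
    obtain ⟨bf, hbf⟩ := hsf.exists_endpoint
    refine Finset.one_lt_card.2 ⟨(e, be), ?_, (f, bf), ?_, fun h => hef (congrArg Prod.fst h)⟩
    · exact Finset.mem_filter.2 ⟨Finset.mem_product.2 ⟨he, Finset.mem_univ _⟩, hbe⟩
    · exact Finset.mem_filter.2 ⟨Finset.mem_product.2 ⟨hf, Finset.mem_univ _⟩, hbf⟩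
  have hfibr : n ^ 2 ≤ (fib (mk r)).card :=
    sq_le_card_endpoints hn (isPhase_top hω hd) fun z hz => hred _ hz
  have hfibb : n ^ 2 ≤ (fib (mk b)).card :=
    sq_le_card_endpoints hn (isPhase_bot hω hd) fun z hz => hblue _ hz
  have hsum : ∑ A ∈ insert (mk r) (insert (mk b) T), (fib A).card ≤ 2 * I.card := by
    rw [← Finset.card_biUnion]
    · calc _ ≤ (I ×ˢ (Finset.univ : Finset Bool)).card := Finset.card_le_card
            (Finset.biUnion_subset.2 fun A _ => Finset.filter_subset _ _)
        _ = 2 * I.card := by rw [Finset.card_product]; simp [mul_comm]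
    · intro A _ B _ hAB
      refine Finset.disjoint_left.2 fun z hz hz' => hAB ?_
      exact (Finset.mem_filter.1 hz).2.symm.trans (Finset.mem_filter.1 hz').2
  rw [Finset.sum_insert (by simp [hT, hrb]), Finset.sum_insert (by simp [hT])] at hsum
  have hTsum : T.card * 2 ≤ ∑ A ∈ T, (fib A).card := by
    rw [← smul_eq_mul]
    exact Finset.card_nsmul_le_sum _ _ _ hfibT
  omega


/-! ### Counting interfaces -/

theorem apply_bounds_of_mem_plaquette {f : Edge} {c : Fin 3 → ℤ}
    (h : (fun j => (c j : ℝ)) ∈ plaquette f) (j : Fin 3) : f.1 j ≤ c j ∧ c j ≤ f.1 j + 1 := by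
  obtain ⟨h1, h2⟩ := mem_plaquette_intCast.1 h
  by_cases hj : j = f.2
  · subst hj
    omega
  · exact h2 j hj

/-- A set of plaquettes containing all those that share an edge with `f`. -/
noncomputable def nbhd (f : Edge) : Finset Edge :=
  (Fintype.piFinset fun j => Finset.Icc (f.1 j - 1) (f.1 j + 1)) ×ˢ Finset.univ

theorem card_nbhd (f : Edge) : (nbhd f).card = 81 := by
  have h : ∀ a : ℤ, (a + 1 + 1 - (a - 1)).toNat = 3 := fun a => by omega
  simp [nbhd, Fintype.card_piFinset, h]

theorem mem_nbhd_self (f : Edge) : f ∈ nbhd f := by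
  simp [nbhd]

theorem ShareEdge.mem_nbhd {f g : Edge} (h : ShareEdge f g) : g ∈ nbhd f := by
  obtain ⟨c, i, ⟨h1, h2⟩, -⟩ := h
  simp only [nbhd, Finset.mem_product, Fintype.mem_piFinset, Finset.mem_Icc, Finset.mem_univ,
    and_true]
  intro j
  have := apply_bounds_of_mem_plaquette h1 j
  have := apply_bounds_of_mem_plaquette h2 j
  omega

/-- A set of plaquettes containing all those of the model that share an edge with a boundary
plaquette. -/
noncomputable def rim (n : ℕ) : Finset Edge :=
  (Fintype.piFinset ![Finset.Ico (-1 : ℤ) n, Finset.Ico (-1 : ℤ) n, Finset.Ico (-1 : ℤ) 1]) ×ˢ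
    Finset.univ

theorem card_rim_le {n : ℕ} (hn : 1 ≤ n) : (rim n).card ≤ 24 * n ^ 2 := by
  have h : (rim n).card = (n + 1) * (n + 1) * 2 * 3 := by
    have h1 : ((n : ℤ) + 1).toNat = n + 1 := by omega
    simp [rim, Fintype.card_piFinset, Fin.prod_univ_succ, h1]
    ring
  rw [h]
  -- 6(n + 1)² ≤ 24n², because n + 1 ≤ 2n.
  nlinarith

/-- Model edges have base coordinates between -1 and n - 1, and a common point at height 0 restricts
the vertical one to -1 or 0. -/
theorem mem_rim {n : ℕ} {b g : Edge} (hb : b ∈ bdryPlaquettes n) (hg : g ∈ edges n)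
    (h : ShareEdge b g) : g ∈ rim n := by
  have hbd : ∀ j, -1 ≤ g.1 j ∧ g.1 j < n := by
    intro j
    rcases mem_edges.1 hg with hm | hm
    · have : 0 ≤ g.1 j ∧ g.1 j < n := mem_box.1 hm j
      omega
    · have : 0 ≤ (g.1 + Pi.single g.2 1 : Site) j ∧ (g.1 + Pi.single g.2 1 : Site) j < n :=
        mem_box.1 hm j
      simp only [Pi.add_apply, Pi.single_apply] at this
      split_ifs at this <;> omega
  obtain ⟨c, i, ⟨h1, h2⟩, -⟩ := h
  have hc := (mem_plaquette_intCast.1 h1).1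
  rw [hb.1] at hc
  have hb2 : b.1 2 = -1 := hb.2.1
  have hg2 := apply_bounds_of_mem_plaquette h2 2
  simp only [rim, Finset.mem_product, Fintype.mem_piFinset, Finset.mem_univ, and_true]
  rw [Fin.forall_fin_succ, Fin.forall_fin_two]
  refine ⟨Finset.mem_Ico.2 (hbd 0), Finset.mem_Ico.2 (hbd 1), Finset.mem_Ico.2 ?_⟩
  change -1 ≤ g.1 2 ∧ g.1 2 < 1
  omega

/-- Closing edges away from the full interface does not change it. -/
theorem fullInterface_eq {n : ℕ} {ω ω' Y : Finset Edge}
    (hY : ∀ f ∈ Y, f ∉ rim n ∧ ∀ e ∈ fullInterface n ω, f ∉ nbhd e)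
    (hω' : edges n \ ω' = fullInterface n ω ∪ Y) :
    fullInterface n ω' = fullInterface n ω := by
  ext f
  constructor
  · intro hf
    obtain ⟨-, b, hb, g, hg, hbg, hp⟩ := mem_fullInterface.1 hf
    have hgE : g ∈ edges n := (Finset.mem_sdiff.1 hg).1
    have hgI : g ∈ fullInterface n ω := by
      rw [hω'] at hg
      exact (Finset.mem_union.1 hg).resolve_right fun h => (hY g h).1 (mem_rim hb hgE hbg)
    induction hp with
    | refl => exact hgI
    | tail h1 h2 ih =>
      obtain ⟨ha, hc, hac⟩ := h2
      have haI := ih (mem_fullInterface.2 ⟨ha, b, hb, g, hg, hbg, h1⟩)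
      rw [hω'] at hc
      exact (Finset.mem_union.1 hc).resolve_right fun h => (hY _ h).2 _ haI hac.mem_nbhd
  · intro hf
    obtain ⟨-, b, hb, g, hg, hbg, hp⟩ := mem_fullInterface.1 hf
    have hsub : ∀ e ∈ fullInterface n ω, e ∈ edges n \ ω' := fun e he => by
      rw [hω']
      exact Finset.mem_union_left _ he
    have hgI := mem_fullInterface_of_bdry hb hg hbg
    have key : f ∈ fullInterface n ω ∧ f ∈ fullInterface n ω' := by
      clear hf
      induction hp with
      | refl => exact ⟨hgI, mem_fullInterface_of_bdry hb (hsub g hgI) hbg⟩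
      | tail _ h2 ih =>
        obtain ⟨ha, hc, hac⟩ := h2
        have hcI := mem_fullInterface_of_shareEdge ih.1 hc hac
        exact ⟨hcI, mem_fullInterface_of_shareEdge ih.2 (hsub _ hcI) hac⟩
    exact key.2

-- Close `I`, open the other model edges of the neighbourhood `N` of `I` and the rim, and choose the
-- model edges off `N` freely: the full interface is always `I`. Only the |N| ≤ 81|I| + 24n² edges
-- are prescribed.
open Classical in
theorem two_pow_card_edges_le {n : ℕ} (hn : 1 ≤ n) (ω : Finset Edge) :
    2 ^ (edges n).card ≤
      ((edges n).powerset.filter fun ω' => fullInterface n ω' = fullInterface n ω).card *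
        2 ^ (81 * (fullInterface n ω).card + 24 * n ^ 2) := by
  set I := fullInterface n ω with hI
  set N := I.biUnion nbhd ∪ rim n with hN
  have hIE : I ⊆ edges n := (fullInterface_subset n ω).trans Finset.sdiff_subset
  have hNcard : N.card ≤ 81 * I.card + 24 * n ^ 2 := by
    refine (Finset.card_union_le _ _).trans (Nat.add_le_add ?_ (card_rim_le hn))
    refine Finset.card_biUnion_le.trans ?_
    simp [card_nbhd, mul_comm]
  have hINdisj : ∀ f ∈ I, f ∈ N := fun f hf =>
    Finset.mem_union_left _ (Finset.mem_biUnion.2 ⟨f, hf, mem_nbhd_self f⟩)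
  have hfree : (edges n \ N).powerset.card ≤
      ((edges n).powerset.filter fun ω' => fullInterface n ω' = I).card := by
    refine Finset.card_le_card_of_injOn (fun Y => edges n \ (I ∪ Y)) (fun Y hY => ?_)
      (fun Y hY Z hZ hYZ => ?_)
    · have hY' := Finset.mem_powerset.1 hY
      refine Finset.mem_filter.2 ⟨Finset.mem_powerset.2 Finset.sdiff_subset, ?_⟩
      refine fullInterface_eq (Y := Y) (fun f hf => ?_) ?_
      · have := (Finset.mem_sdiff.1 (hY' hf)).2
        exact ⟨fun h => this (Finset.mem_union_right _ h), fun e he h =>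
          this (Finset.mem_union_left _ (Finset.mem_biUnion.2 ⟨e, he, h⟩))⟩
      · exact Finset.sdiff_sdiff_eq_self
          (Finset.union_subset hIE (hY'.trans Finset.sdiff_subset))
    · have hrec : ∀ Y ∈ (edges n \ N).powerset, Y = (edges n \ (edges n \ (I ∪ Y))) \ I := by
        intro Y hY
        have hY' := Finset.mem_powerset.1 hY
        rw [Finset.sdiff_sdiff_eq_self
          (Finset.union_subset hIE (hY'.trans Finset.sdiff_subset)), Finset.union_sdiff_left]
        refine (Finset.sdiff_eq_self_of_disjoint (Finset.disjoint_left.2 fun f hf hfI => ?_)).symm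
        exact (Finset.mem_sdiff.1 (hY' hf)).2 (hINdisj f hfI)
      have hYZ' : edges n \ (I ∪ Y) = edges n \ (I ∪ Z) := hYZ
      rw [hrec Y hY, hrec Z hZ, hYZ']
  rw [Finset.card_powerset] at hfree
  calc 2 ^ (edges n).card ≤ 2 ^ ((edges n \ N).card + (81 * I.card + 24 * n ^ 2)) := by
        refine Nat.pow_le_pow_right (by norm_num) ?_
        have := Finset.le_card_sdiff N (edges n)
        omega
    _ = 2 ^ (edges n \ N).card * 2 ^ (81 * I.card + 24 * n ^ 2) := pow_add _ _ _
    _ ≤ _ := Nat.mul_le_mul_right _ hfree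

open Classical in
/-- A weighted count of the possible full interfaces. -/
theorem sum_half_pow_le_one {n : ℕ} (hn : 1 ≤ n) :
    ∑ I ∈ (edges n).powerset.image (fullInterface n), (1 / 2 : ℝ) ^ (81 * I.card + 24 * n ^ 2) ≤
      1 := by
  -- The fibres of the full interface partition the 2^|E| configurations, so the lower bounds on the
  -- fibre proportions sum to at most 1.
  have hpos : (0 : ℝ) < 2 ^ (edges n).card := by positivity
  have hsum : ∑ I ∈ (edges n).powerset.image (fullInterface n),
      ((edges n).powerset.filter fun ω' => fullInterface n ω' = I).card =
        2 ^ (edges n).card := by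
    rw [← Finset.card_eq_sum_card_image, Finset.card_powerset]
  have hterm : ∀ I ∈ (edges n).powerset.image (fullInterface n),
      (2 : ℝ) ^ (edges n).card * (1 / 2 : ℝ) ^ (81 * I.card + 24 * n ^ 2) ≤
        (((edges n).powerset.filter fun ω' => fullInterface n ω' = I).card : ℝ) := by
    intro I hI
    obtain ⟨ω, -, rfl⟩ := Finset.mem_image.1 hI
    have := two_pow_card_edges_le hn ω
    rw [one_div, inv_pow, ← div_eq_mul_inv, div_le_iff₀ (by positivity)]
    exact_mod_cast this
  have := Finset.sum_le_sum hterm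
  rw [← Finset.mul_sum, ← Nat.cast_sum, hsum] at this
  push_cast at this
  exact le_of_mul_le_mul_left (by simpa using this) hpos

/-! ### Flattening the interface -/

/-- The edges joining the box to the floor. -/
noncomputable def floorEdges (n : ℕ) : Finset Edge :=
  (columns n).image fun x => ((![x.1, x.2, -1] : Site), (2 : Fin 3))

theorem card_floorEdges_le (n : ℕ) : (floorEdges n).card ≤ n ^ 2 := by
  refine Finset.card_image_le.trans (le_of_eq ?_)
  simp [columns, sq]

theorem mem_floorEdges {n : ℕ} {e : Edge} (he : e ∈ edges n)
    (h : tail e ∈ blueBdry n ∨ head e ∈ blueBdry n) : e ∈ floorEdges n := by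
  obtain ⟨x, i⟩ := e
  have hh : ∀ j, (x + Pi.single i 1 : Site) j = x j + if j = i then 1 else 0 := by
    simp [Pi.single_apply]
  simp only [tail, head] at h
  have he' := mem_edges.1 he
  simp only [tail, head] at he'
  rcases h with ⟨hb, h0⟩ | ⟨hb, h0⟩
  · have hx := mem_box.1 (he'.resolve_left hb.1)
    simp only [hh] at hx
    have h2 := hx 2
    have hi : i = 2 := by
      by_contra hi
      rw [if_neg (Ne.symm hi)] at h2
      omega
    subst hi
    have hx0 := hx 0
    have hx1 := hx 1
    simp at h2 hx0 hx1
    refine Finset.mem_image.2 ⟨(x 0, x 1), mem_columns.2 ⟨hx0, hx1⟩, ?_⟩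
    rw [Prod.mk.injEq]
    refine ⟨?_, rfl⟩
    rw [site_eq_vec x, show x 2 = -1 by omega]
    rfl
  · have hx := mem_box.1 (he'.resolve_right hb.1) 2
    rw [hh] at h0
    split_ifs at h0 <;> omega

/-- The configuration with the interface `I` replaced by the floor. -/
noncomputable def flatten (n : ℕ) (I ω : Finset Edge) : Finset Edge := (ω ∪ I) \ floorEdges n

theorem flatten_subset {n : ℕ} {I ω : Finset Edge} (hω : ω ⊆ edges n) (hI : I ⊆ edges n) :
    flatten n I ω ⊆ edges n :=
  Finset.sdiff_subset.trans (Finset.union_subset hω hI)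

/-- Every model edge at a blue boundary site is a floor edge, so these sites are isolated once the
floor is closed. -/
theorem disconnected_of_disjoint_floorEdges {n : ℕ} {ω : Finset Edge} (hω : ω ⊆ edges n)
    (h : Disjoint ω (floorEdges n)) : Disconnected n ω := by
  intro x hx y hy hxy
  have := (iff_of_reachable (P := fun z => z ∈ blueBdry n) hxy.symm fun a b _ hab => ?_).1 hy
  · exact absurd this.2 (not_lt.2 hx.2)
  · refine iff_of_false (fun ha => ?_) (fun hb => ?_)
    · obtain ⟨e, he, ⟨rfl, rfl⟩ | ⟨rfl, rfl⟩⟩ := openGraph_adj.1 hab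
      · exact Finset.disjoint_left.1 h he (mem_floorEdges (hω he) (Or.inl ha))
      · exact Finset.disjoint_left.1 h he (mem_floorEdges (hω he) (Or.inr ha))
    · obtain ⟨e, he, ⟨rfl, rfl⟩ | ⟨rfl, rfl⟩⟩ := openGraph_adj.1 hab
      · exact Finset.disjoint_left.1 h he (mem_floorEdges (hω he) (Or.inr hb))
      · exact Finset.disjoint_left.1 h he (mem_floorEdges (hω he) (Or.inl hb))

theorem fkWeight_nonneg {n : ℕ} {p : ℝ} {q : ℕ} (hr : 1 ≤ p / (1 - p)) (ω : Finset Edge) :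
    0 ≤ fkWeight n p q ω := by
  unfold fkWeight
  positivity

theorem disjoint_fullInterface (n : ℕ) (ω : Finset Edge) : Disjoint ω (fullInterface n ω) :=
  Finset.disjoint_left.2 fun _ he hI => (Finset.mem_sdiff.1 (fullInterface_subset n ω hI)).2 he

/-- The energy cost of an interface of excess area `M`. -/
theorem fkWeight_mul_le {n : ℕ} (hn : 1 ≤ n) {p : ℝ} {q : ℕ} (hq : 1 ≤ q)
    (hr : 1 ≤ p / (1 - p)) {ω : Finset Edge} (hω : ω ⊆ edges n) (hd : Disconnected n ω) {M : ℕ}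
    (hM : 1 ≤ M) (hcard : (fullInterface n ω).card = n ^ 2 + M) :
    fkWeight n p q ω * (p / (1 - p)) ^ M ≤
      ((q : ℝ) ^ 3) ^ M * fkWeight n p q (flatten n (fullInterface n ω) ω) := by
  set I := fullInterface n ω with hI
  have hedge : ω.card + M ≤ (flatten n I ω).card := by
    have h1 : (ω ∪ I).card = ω.card + I.card :=
      Finset.card_union_of_disjoint (disjoint_fullInterface n ω)
    have h2 := Finset.le_card_sdiff (floorEdges n) (ω ∪ I)
    have h3 := card_floorEdges_le n
    have h4 : (flatten n I ω).card = ((ω ∪ I) \ floorEdges n).card := rfl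
    omega
  -- The loss M + 2 is absorbed in 3M since M ≥ 1. This is where the factor q³ per unit of excess
  -- area comes from.
  have hclu : clusterCount n ω ≤ 3 * M + clusterCount n (flatten n I ω) := by
    have h1 := clusterCount_le_add_touched n ω I
    have h2 := ncard_touched_add_le hn hω hd
    have h3 : clusterCount n (ω ∪ I) ≤ clusterCount n (flatten n I ω) :=
      clusterCount_anti n Finset.sdiff_subset
    rw [← hI, hcard] at h2
    omega
  have hq' : (1 : ℝ) ≤ q := by exact_mod_cast hq
  unfold fkWeight
  calc (p / (1 - p)) ^ ω.card * (q : ℝ) ^ clusterCount n ω * (p / (1 - p)) ^ M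
      = (p / (1 - p)) ^ (ω.card + M) * (q : ℝ) ^ clusterCount n ω := by rw [pow_add]; ring
    _ ≤ (p / (1 - p)) ^ (flatten n I ω).card *
          (q : ℝ) ^ (3 * M + clusterCount n (flatten n I ω)) := by
        refine mul_le_mul (pow_le_pow_right₀ hr hedge) (pow_le_pow_right₀ hq' hclu) ?_ ?_ <;>
          positivity
    _ = _ := by rw [pow_add, pow_mul]; ring

open Classical in
/-- The total weight of the configurations with a given full interface. -/
theorem sum_fkWeight_mul_le {n : ℕ} (hn : 1 ≤ n) {p : ℝ} {q : ℕ} (hq : 1 ≤ q)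
    (hr : 1 ≤ p / (1 - p)) {I : Finset Edge} {M : ℕ} (hM : 1 ≤ M) (hcard : I.card = n ^ 2 + M) :
    (∑ ω ∈ (edges n).powerset with Disconnected n ω ∧ fullInterface n ω = I, fkWeight n p q ω) *
        (p / (1 - p)) ^ M ≤
      ((q : ℝ) ^ 3) ^ M * (2 ^ n ^ 2 *
        ∑ ω ∈ (edges n).powerset with Disconnected n ω, fkWeight n p q ω) := by
  set Ω := (edges n).powerset.filter fun ω => Disconnected n ω ∧ fullInterface n ω = I with hΩ
  have hmem : ∀ ω ∈ Ω, ω ⊆ edges n ∧ Disconnected n ω ∧ fullInterface n ω = I := fun ω h => by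
    obtain ⟨h1, h2⟩ := Finset.mem_filter.1 h
    exact ⟨Finset.mem_powerset.1 h1, h2⟩
  have hmaps : ∑ ω ∈ Ω, fkWeight n p q (flatten n I ω) ≤
      ∑ z ∈ ((edges n).powerset.filter fun ω => Disconnected n ω) ×ˢ (floorEdges n).powerset,
        fkWeight n p q z.1 := by
    -- Since `ω` is disjoint from `I`, it can be recovered from its flattening and its trace on the
    -- floor.
    rw [← Finset.sum_image (s := Ω) (g := fun ω => (flatten n I ω, ω ∩ floorEdges n))
      (f := fun z : Finset Edge × Finset Edge => fkWeight n p q z.1)]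
    · refine Finset.sum_le_sum_of_subset_of_nonneg ?_ fun z _ _ => fkWeight_nonneg hr _
      intro z hz
      obtain ⟨ω, hω, rfl⟩ := Finset.mem_image.1 hz
      obtain ⟨h1, -, h3⟩ := hmem ω hω
      have hsub : flatten n I ω ⊆ edges n :=
        flatten_subset h1 (h3 ▸ (fullInterface_subset n ω).trans Finset.sdiff_subset)
      refine Finset.mem_product.2 ⟨Finset.mem_filter.2 ⟨Finset.mem_powerset.2 hsub, ?_⟩,
        Finset.mem_powerset.2 Finset.inter_subset_right⟩
      exact disconnected_of_disjoint_floorEdges hsub Finset.sdiff_disjoint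
    · intro ω hω ω' hω' h
      obtain ⟨-, -, h3⟩ := hmem ω hω
      obtain ⟨-, -, h3'⟩ := hmem ω' hω'
      have hrec : ∀ ω, Disjoint ω I → ω = (flatten n I ω \ I) ∪ (ω ∩ floorEdges n) := by
        intro ω hdis
        ext e
        have hdis' : e ∈ ω → e ∉ I := fun h => Finset.disjoint_left.1 hdis h
        simp only [flatten, Finset.mem_union, Finset.mem_sdiff, Finset.mem_inter]
        by_cases h1 : e ∈ ω <;> by_cases h2 : e ∈ floorEdges n <;> simp_all
      simp only [Prod.mk.injEq] at h
      rw [hrec ω (h3 ▸ disjoint_fullInterface n ω), hrec ω' (h3' ▸ disjoint_fullInterface n ω'),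
        h.1, h.2]
  have hZ : 0 ≤ ∑ ω ∈ (edges n).powerset with Disconnected n ω, fkWeight n p q ω :=
    Finset.sum_nonneg fun _ _ => fkWeight_nonneg hr _
  rw [Finset.sum_mul]
  calc ∑ ω ∈ Ω, fkWeight n p q ω * (p / (1 - p)) ^ M
      ≤ ∑ ω ∈ Ω, ((q : ℝ) ^ 3) ^ M * fkWeight n p q (flatten n I ω) := by
        refine Finset.sum_le_sum fun ω hω => ?_
        obtain ⟨h1, h2, h3⟩ := hmem ω hω
        have := fkWeight_mul_le hn hq hr h1 h2 hM (h3 ▸ hcard)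
        rwa [h3] at this
    _ = ((q : ℝ) ^ 3) ^ M * ∑ ω ∈ Ω, fkWeight n p q (flatten n I ω) :=
        (Finset.mul_sum _ _ _).symm
    _ ≤ _ := by
        refine mul_le_mul_of_nonneg_left (hmaps.trans ?_) (by positivity)
        rw [Finset.sum_product_right]
        dsimp only
        rw [Finset.sum_const, Finset.card_powerset, nsmul_eq_mul]
        push_cast
        refine mul_le_mul_of_nonneg_right ?_ hZ
        exact pow_le_pow_right₀ (by norm_num) (card_floorEdges_le n)

/-! ### The area estimate -/

/-- At low temperature, the energy cost beats the entropy. -/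
theorem entropy_mul_energy_le {β K : ℝ} (hK : 1 ≤ K) (hβ : 2 * Real.log (K + 1) ≤ β) :
    1 ≤ Real.exp β - 1 ∧ K * Real.exp (β / 2) ≤ Real.exp β - 1 := by
  -- With y = e^(β/2) ≥ K + 1, one has y² - Ky ≥ y ≥ 1.
  have hy : K + 1 ≤ Real.exp (β / 2) := by
    rw [← Real.log_le_iff_le_exp (by linarith)]
    linarith
  have hsq : Real.exp β = Real.exp (β / 2) * Real.exp (β / 2) := by
    rw [← Real.exp_add]
    ring_nf
  rw [hsq]
  constructor <;> nlinarith

/-- The prefactor 2^81 Q of `r` absorbs the entropy and cluster cost per unit of excess area. The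
remaining e^(βM/2) is at least e^(107n²), since 214 = 2 · 107 and 107 = 81 + 24 + 1 + 1: the base
area and the rim in the entropy weight, the floor states, and the final e^(-n²). -/
theorem peierls_bound {β r Q : ℝ} (hβ : 0 < β) (hQ : 1 ≤ Q) (hr : 2 ^ 81 * Q * Real.exp (β / 2) ≤ r)
    {n M : ℕ} (hM : 214 / β * (n : ℝ) ^ 2 ≤ M) :
    Q ^ M * 2 ^ n ^ 2 ≤
      Real.exp (-(n : ℝ) ^ 2) * (1 / 2) ^ (81 * (n ^ 2 + M) + 24 * n ^ 2) * r ^ M := by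
  have h1 : (2 ^ 81 * Q * Real.exp (β / 2)) ^ M ≤ r ^ M := pow_le_pow_left₀ (by positivity) hr M
  have h2 : (2 : ℝ) ^ (106 * n ^ 2) ≤ Real.exp (106 * (n : ℝ) ^ 2) := by
    have h : (2 : ℝ) ≤ Real.exp 1 := by
      have := Real.add_one_le_exp 1
      linarith
    calc (2 : ℝ) ^ (106 * n ^ 2) ≤ Real.exp 1 ^ (106 * n ^ 2) := pow_le_pow_left₀ (by norm_num) h _
      _ = _ := by rw [← Real.exp_nat_mul]; push_cast; ring_nf
  have h3 : Real.exp (107 * (n : ℝ) ^ 2) ≤ Real.exp (β / 2) ^ M := by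
    rw [← Real.exp_nat_mul, Real.exp_le_exp]
    rw [div_mul_eq_mul_div, div_le_iff₀ hβ] at hM
    linarith
  have h4 : Real.exp (107 * (n : ℝ) ^ 2) =
      Real.exp (106 * (n : ℝ) ^ 2) * Real.exp ((n : ℝ) ^ 2) := by
    rw [← Real.exp_add]
    ring_nf
  have h5 : (2 : ℝ) ^ (106 * n ^ 2) * Real.exp ((n : ℝ) ^ 2) ≤ Real.exp (β / 2) ^ M :=
    (mul_le_mul_of_nonneg_right h2 (Real.exp_pos _).le).trans (h4 ▸ h3)
  have hexp : Real.exp ((n : ℝ) ^ 2) * Real.exp (-(n : ℝ) ^ 2) = 1 := by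
    rw [← Real.exp_add]
    simp
  have hhalf : (1 / 2 : ℝ) ^ (81 * (n ^ 2 + M) + 24 * n ^ 2) * 2 ^ (105 * n ^ 2) * (2 ^ 81) ^ M
      = 1 := by
    rw [← pow_mul, mul_assoc, ← pow_add,
      show 105 * n ^ 2 + 81 * M = 81 * (n ^ 2 + M) + 24 * n ^ 2 by ring, ← mul_pow]
    norm_num
  set h := (1 / 2 : ℝ) ^ (81 * (n ^ 2 + M) + 24 * n ^ 2) with hh
  have hsplit : (2 : ℝ) ^ (106 * n ^ 2) = 2 ^ (105 * n ^ 2) * 2 ^ n ^ 2 := by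
    rw [← pow_add]
    ring_nf
  calc Q ^ M * 2 ^ n ^ 2
      = (h * 2 ^ (105 * n ^ 2) * (2 ^ 81) ^ M) *
          (Real.exp ((n : ℝ) ^ 2) * Real.exp (-(n : ℝ) ^ 2)) * (Q ^ M * 2 ^ n ^ 2) := by
        rw [hhalf, hexp]
        ring
    _ = Real.exp (-(n : ℝ) ^ 2) * h * ((2 ^ 81) ^ M * Q ^ M *
          (2 ^ (106 * n ^ 2) * Real.exp ((n : ℝ) ^ 2))) := by
        rw [hsplit]
        ring
    _ ≤ Real.exp (-(n : ℝ) ^ 2) * h * ((2 ^ 81) ^ M * Q ^ M * Real.exp (β / 2) ^ M) := by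
        gcongr
    _ = Real.exp (-(n : ℝ) ^ 2) * h * (2 ^ 81 * Q * Real.exp (β / 2)) ^ M := by
        rw [mul_pow, mul_pow]
    _ ≤ _ := by gcongr

theorem fkProb_area_le {n q : ℕ} (hn : 1 ≤ n) (hq : 1 ≤ q) {β : ℝ} (hβ0 : 0 < β)
    (hβ : 2 * Real.log (2 ^ 81 * (q : ℝ) ^ 3 + 1) ≤ β) :
    fkProb n (1 - Real.exp (-β)) q
      {ω | (1 + 214 / β) * (n : ℝ) ^ 2 ≤ ((fullInterface n ω).card : ℝ)} ≤
        Real.exp (-(n : ℝ) ^ 2) := by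
  classical
  set p := 1 - Real.exp (-β) with hp
  have hq' : (1 : ℝ) ≤ (q : ℝ) ^ 3 := one_le_pow₀ (by exact_mod_cast hq)
  have hr : p / (1 - p) = Real.exp β - 1 := by
    rw [hp, sub_sub_cancel, Real.exp_neg]
    field_simp
  obtain ⟨hr1, hr2⟩ := entropy_mul_energy_le (K := 2 ^ 81 * (q : ℝ) ^ 3) (by nlinarith) hβ
  rw [← hr] at hr1 hr2
  have hw : ∀ ω, 0 ≤ fkWeight n p q ω := fun ω => fkWeight_nonneg hr1 ω
  set Z := ∑ ω ∈ (edges n).powerset with Disconnected n ω, fkWeight n p q ω with hZ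
  have hZ0 : 0 ≤ Z := Finset.sum_nonneg fun ω _ => hw ω
  set Ω := (edges n).powerset.filter fun ω => Disconnected n ω ∧
    ω ∈ {ω | (1 + 214 / β) * (n : ℝ) ^ 2 ≤ ((fullInterface n ω).card : ℝ)} with hΩ
  have hterm : ∀ I ∈ Ω.image (fullInterface n),
      ∑ ω ∈ Ω with fullInterface n ω = I, fkWeight n p q ω ≤
        Real.exp (-(n : ℝ) ^ 2) * Z * (1 / 2) ^ (81 * I.card + 24 * n ^ 2) := by
    intro I hI
    obtain ⟨ω₀, hω₀, hI₀⟩ := Finset.mem_image.1 hI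
    have hlarge : (1 + 214 / β) * (n : ℝ) ^ 2 ≤ (I.card : ℝ) :=
      hI₀ ▸ (Finset.mem_filter.1 hω₀).2.2
    have hexc : 0 < 214 / β * (n : ℝ) ^ 2 := by positivity
    -- Strictness makes the excess at least 1, as the cluster bound 3M requires.
    have hlt : n ^ 2 < I.card := by
      have : ((n ^ 2 : ℕ) : ℝ) < I.card := by push_cast; linarith
      exact_mod_cast this
    obtain ⟨M, hM⟩ := Nat.exists_eq_add_of_lt hlt
    have hcard : I.card = n ^ 2 + (M + 1) := by omega
    have hMr : 214 / β * (n : ℝ) ^ 2 ≤ ((M + 1 : ℕ) : ℝ) := by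
      rw [hcard] at hlarge
      push_cast at hlarge ⊢
      linarith
    have h1 := sum_fkWeight_mul_le hn hq hr1 (I := I) (M := M + 1) (by omega) hcard
    have h2 := peierls_bound hβ0 hq' hr2 hMr
    have h3 : ∑ ω ∈ Ω with fullInterface n ω = I, fkWeight n p q ω ≤
        ∑ ω ∈ (edges n).powerset with Disconnected n ω ∧ fullInterface n ω = I,
          fkWeight n p q ω := by
      refine Finset.sum_le_sum_of_subset_of_nonneg (fun ω hω => ?_) fun ω _ _ => hw ω
      obtain ⟨h4, h5⟩ := Finset.mem_filter.1 hω
      obtain ⟨h6, h7⟩ := Finset.mem_filter.1 h4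
      exact Finset.mem_filter.2 ⟨h6, h7.1, h5⟩
    have hrpos : 0 < (p / (1 - p)) ^ (M + 1) := by positivity
    refine h3.trans (le_of_mul_le_mul_right (h1.trans ?_) hrpos)
    rw [hcard]
    calc ((q : ℝ) ^ 3) ^ (M + 1) * (2 ^ n ^ 2 * Z)
        = ((q : ℝ) ^ 3) ^ (M + 1) * 2 ^ n ^ 2 * Z := by ring
      _ ≤ _ := mul_le_mul_of_nonneg_right h2 hZ0
      _ = _ := by ring
  have hsum : ∑ ω ∈ Ω, fkWeight n p q ω ≤ Real.exp (-(n : ℝ) ^ 2) * Z := by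
    rw [← Finset.sum_fiberwise_of_maps_to
      (fun ω hω => Finset.mem_image_of_mem (fullInterface n) hω)]
    refine (Finset.sum_le_sum hterm).trans ?_
    rw [← Finset.mul_sum]
    refine mul_le_of_le_one_right (by positivity) (le_trans ?_ (sum_half_pow_le_one hn))
    exact Finset.sum_le_sum_of_subset_of_nonneg
      (Finset.image_subset_image (Finset.filter_subset _ _)) fun _ _ _ => by positivity
  unfold fkProb
  refine div_le_of_le_mul₀ ?_ (Real.exp_pos _).le ?_
  · convert hZ0
  · convert hsum

end HardFloor

open HardFloor in
theorem lemma2p17 :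
    ∃ C : ℝ, 0 < C ∧ ∀ q : ℕ, 2 ≤ q → ∃ β₀ : ℝ, 0 < β₀ ∧ ∀ β : ℝ, β₀ ≤ β →
      ∀ n : ℕ, 1 ≤ n →
        fkProb n (1 - Real.exp (-β)) q
            {ω | (1 + C / β) * (n : ℝ) ^ 2 ≤ ((fullInterface n ω).card : ℝ)}
          ≤ Real.exp (-(n : ℝ) ^ 2) ∧
        ∀ (ω : Finset Edge) (σ : box n → ℕ),
          0 < jointProb n (1 - Real.exp (-β)) q {(ω, σ)} →
          ((fullInterface n ω).card : ℝ) < (1 + C / β) * (n : ℝ) ^ 2 →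
            (({x ∈ columns n | minHeight (fullInterface n ω) x ≠
                maxHeight (fullInterface n ω) x}.card : ℕ) : ℝ) ≤ C / β * (n : ℝ) ^ 2 ∧
            ∀ x ∈ columns n,
              minHeight (fullInterface n ω) x = maxHeight (fullInterface n ω) x →
              ∃ f : Edge,
                above (fullInterface n ω) x = {f} ∧
                above (botInterface n ω) x = {f} ∧
                above (blueInterface n σ) x = {f} ∧
                above (redInterface n σ) x = {f} ∧
                above (topInterface n ω) x = {f} := by
  refine ⟨214, by norm_num, fun q hq => ?_⟩
  have hK : (1 : ℝ) < 2 ^ 81 * (q : ℝ) ^ 3 + 1 := by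
    have : (0 : ℝ) < q := by exact_mod_cast (by omega : 0 < q)
    have : (0 : ℝ) < 2 ^ 81 * (q : ℝ) ^ 3 := by positivity
    linarith
  have hβ₀ : 0 < 2 * Real.log (2 ^ 81 * (q : ℝ) ^ 3 + 1) := by
    have := Real.log_pos hK
    linarith
  refine ⟨_, hβ₀, fun β hβ n hn =>
    ⟨fkProb_area_le hn (by omega) (hβ₀.trans_le hβ) hβ, fun ω σ hpos hcard => ?_⟩⟩
  obtain ⟨hω, hσ⟩ := compatible_of_jointProb_pos hpos
  refine ⟨?_, fun x hx h => exists_common_plaquette hω hσ hn hx h⟩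
  -- The columns with unequal extreme heights number at most |I| - n², which the area assumption
  -- bounds.
  have hle := card_columns_add_le (I := fullInterface n ω)
    fun x hx => exists_above hω (disconnected_of_compatible hσ) hn hx
  have hle' : ((n : ℝ) ^ 2 + ({x ∈ columns n | minHeight (fullInterface n ω) x ≠
      maxHeight (fullInterface n ω) x}.card : ℕ) : ℝ) ≤ (fullInterface n ω).card := by
    refine le_trans (le_of_eq ?_) (Nat.cast_le.2 hle)
    push_cast
    congr!
  linarith
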